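/- \textbf{Theorem A.} Every Meissner polyhedron in $\mathbb{R}^3$ is an extreme constant width body. Here the terms have the following meaning. \emph{Constant width bodies.} A constant width body is a convex body $K\subset\mathbb{R}^3$ such that the distance between any two parallel supporting planes of $K$ equals $1$. It is called extreme if $K\ne(1-\lambda)K_0+\lambda K_1$ (Minkowski combination) for all $\lambda\in(0,1)$ and all constant width bodies $K_0,K_1\subset\mathbb{R}^3$ which are not translates of each other. \emph{Reuleaux polyhedra.} For $S\subset\mathbb{R}^3$ let $B(S)=\bigcap_{x\in S}B(x)$, where $B(x)$ is the closed ball of radius one centered at $x$. Let $X\subset\mathbb{R}^3$ be a finite set with $m\ge 4$ points and diameter $1$ which is tight ($B(X\setminus\{x\})\ne B(X)$ for each $x\in X$) and extremal (exactly $2m-2$ of the pairs $\{x,y\}\subset X$ satisfy $|x-y|=1$). Then $B(X)$ is called a Reuleaux polyhedron. Its edges are the connected components of the sets $(\partial B(x)\cap\partial B(y)\cap B(X))\setminus X$, where $x,y$ range over distinct points of $X$; the endpoints of an edge $e$ are the points of $\overline e\setminus e$. Edges $e,e'$ of $B(X)$ are dual if there are $x\neq y$ and $x'\neq y'$ in $X$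 such that $e$ is a component of $(\partial B(x)\cap\partial B(y)\cap B(X))\setminus X$ with endpoints $x',y'$, and $e'$ is a component of $(\partial B(x')\cap\partial B(y')\cap B(X))\setminus X$ with endpoints $x,y$. \emph{Meissner polyhedra.} Let $(e_1,e_1'),\dots,(e_{m-1},e_{m-1}')$ be the dual edge pairs of $B(X)$, so that every edge of $B(X)$ occurs exactly once among $e_1,e_1',\dots,e_{m-1},e_{m-1}'$; which edge of each pair is called $e_i$ is an arbitrary choice. Then $$M=B(X\cup e_1\cup\dots\cup e_{m-1})$$ is called a Meissner polyhedron. In particular, each such $M$ is itself a constant width body. -/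

import Mathlib

open scoped Pointwise

/-- Euclidean three-space. -/
abbrev E3 : Type := EuclideanSpace ℝ (Fin 3)

/-- The width of `K` in the direction of the unit vector `u`: the distance between the two
supporting planes of `K` that are orthogonal to `u`. -/
noncomputable def widthInDirection (K : Set E3) (u : E3) : ℝ :=
  sSup ((fun z => inner ℝ u z) '' K) - sInf ((fun z => inner ℝ u z) '' K)

/-- A constant width body: a nonempty compact convex set whose width in every direction is
equal to one (such a set automatically has interior points). -/
structure IsConstantWidth (K : Set E3) : Prop where
  convex : Convex ℝ K
  isCompact : IsCompact K
  nonempty : K.Nonempty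
  width_eq_one : ∀ u : E3, ‖u‖ = 1 → widthInDirection K u = 1

/-- `L` is a translate of `K`. -/
def IsTranslate (K L : Set E3) : Prop :=
  ∃ b : E3, L = (fun z => z + b) '' K

/-- `K` is an extreme constant width body: it has constant width, and it is not equal to
`(1 - t) K₀ + t K₁` (a Minkowski combination) for any `0 < t < 1` and any constant width bodies
`K₀`, `K₁` which are not translates of each other. -/
structure IsExtremeBody (K : Set E3) : Prop where
  isConstantWidth : IsConstantWidth K
  ne_combination : ∀ t : ℝ, 0 < t → t < 1 → ∀ K₀ K₁ : Set E3,
    IsConstantWidth K₀ → IsConstantWidth K₁ → ¬ IsTranslate K₀ K₁ →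
      K ≠ (1 - t) • K₀ + t • K₁

/-- `B(S)`: the intersection of the closed unit balls centered at the points of `S`. -/
def ballIntersection (S : Set E3) : Set E3 :=
  ⋂ x ∈ S, Metric.closedBall x 1

/-- `X` is tight: no center can be removed without changing `B(X)`. -/
def IsTight (X : Set E3) : Prop :=
  ∀ x ∈ X, ballIntersection (X \ {x}) ≠ ballIntersection X

/-- The unordered pairs `{x, y}` of points of `X` at distance one. -/
def diametricPairs (X : Set E3) : Set (Set E3) :=
  {P | ∃ x ∈ X, ∃ y ∈ X, dist x y = 1 ∧ P = {x, y}}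

/-- `B(X)` is a Reuleaux polyhedron: `X` is a tight finite set of at least four points, of
diameter one, and is extremal, that is, has exactly `2 #X - 2` diametric pairs. -/
structure IsReuleauxCenterSet (X : Set E3) : Prop where
  finite : X.Finite
  four_le_ncard : 4 ≤ X.ncard
  diam_eq_one : Metric.diam X = 1
  tight : IsTight X
  extremal : (diametricPairs X).ncard = 2 * X.ncard - 2

/-- `∂B(x) ∩ ∂B(y) ∩ B(X) \ X`. -/
def edgeLocus (X : Set E3) (x y : E3) : Set E3 :=
  (Metric.sphere x 1 ∩ Metric.sphere y 1 ∩ ballIntersection X) \ X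

/-- `e` is an edge of `B(X)` on the spheres centered at the distinct points `x`, `y` of `X`:
a connected component of `∂B(x) ∩ ∂B(y) ∩ B(X) \ X`. -/
def IsEdgeOn (X : Set E3) (x y : E3) (e : Set E3) : Prop :=
  x ∈ X ∧ y ∈ X ∧ x ≠ y ∧
    ∃ z ∈ edgeLocus X x y, e = connectedComponentIn (edgeLocus X x y) z

/-- `e` is an edge of `B(X)`. -/
def IsEdge (X : Set E3) (e : Set E3) : Prop :=
  ∃ x y : E3, IsEdgeOn X x y e

/-- The endpoints of `e` are the two distinct points `p` and `q`. (Edges are open arcs, the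
points of `X` being removed from them.) -/
def HasEndpoints (e : Set E3) (p q : E3) : Prop :=
  p ≠ q ∧ closure e \ e = {p, q}

/-- `e`, `e'` are dual edges of `B(X)`: `e` lies on the spheres centered at `x`, `y` and has
endpoints `x'`, `y'`, while `e'` lies on the spheres centered at `x'`, `y'` and has endpoints
`x`, `y`. -/
def IsDualEdgePair (X : Set E3) (e e' : Set E3) : Prop :=
  ∃ x y x' y' : E3,
    IsEdgeOn X x y e ∧ HasEndpoints e x' y' ∧ IsEdgeOn X x' y' e' ∧ HasEndpoints e' x y

/-- `(e 0, e' 0), …, (e (k - 1), e' (k - 1))` are the dual edge pairs of `B(X)`: each of them is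
a dual edge pair, and every edge of `B(X)` occurs exactly once among the `e i` and `e' i`. -/
structure IsDualEdgePairing (X : Set E3) {k : ℕ} (e e' : Fin k → Set E3) : Prop where
  dual : ∀ i, IsDualEdgePair X (e i) (e' i)
  injective : Function.Injective (Sum.elim e e')
  exhaustive : ∀ a : Set E3, IsEdge X a → ∃ i, a = e i ∨ a = e' i

/-- `M` is a Meissner polyhedron: `M = B(X ∪ e₁ ∪ ⋯ ∪ e_{m-1})`, where `B(X)` is a Reuleaux
polyhedron, `m = #X`, and `(e₁, e₁'), …, (e_{m-1}, e_{m-1}')` are its dual edge pairs. -/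
def IsMeissnerPolyhedron (M : Set E3) : Prop :=
  ∃ X : Set E3, IsReuleauxCenterSet X ∧
    ∃ e e' : Fin (X.ncard - 1) → Set E3, IsDualEdgePairing X e e' ∧
      M = ballIntersection (X ∪ ⋃ i, e i)

/-! Write M = B(S) with S = X ∪ ⋃ eᵢ. It has to be shown that M has constant width and that it
cannot be decomposed.

Indecomposability (`isExtremeBody_of_finite`). If M = (1−t)K₀ + tK₁, the support points satisfy f =
(1−t)f₀ + tf₁ on the unit sphere. The difference c = f₀ − f₁ is continuous; it is even, because
fᵢ(u) = fᵢ(−u) + u for both bodies; and it is constant on the normals of each boundary point of M.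
So c is a function of the boundary point with equal values at both ends of every diameter. From any
boundary point a diameter leads into S, and if it ends on an edge eᵢ, a second one leads on to a
center in X. Hence c takes finitely many values, is constant by connectedness of the sphere, and K₁
is a translate of K₀.

Constant width (`isConstantWidth_ballIntersection`). It suffices that S ⊆ B(S) and that B(S) has
diameter at most 1. For the first, points of edges that are not dual must have distance at most 1
(`DualEdges.dist_le_one`). A farthest pair at distance > 1 would give opposite normals, each
interior to the normal cone of its edge. But the opposite of a normal along e supports B(X) at a
point of the dual edge or at a point whose active ball is centered at an endpoint of e
(`DualFrame.normal_cases`), and neither fits a point of an edge other than the dual one. For the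
second, a point of M outside S has at most one active ball (`active_unique`), so a longest segment
of length > 1 passes through the center s of that ball. Some t ∈ X has distance 1 from s, yet the
whole segment is in the unit ball around t, so s would be interior to that ball. -/

theorem norm_inv_norm_smul {v : E3} (h : 0 < ‖v‖) : ‖(‖v‖)⁻¹ • v‖ = 1 := by
  rw [norm_smul, norm_inv, norm_norm, inv_mul_cancel₀ h.ne']

/-! ### Intersections of unit balls -/

theorem mem_ballIntersection {S : Set E3} {p : E3} :
    p ∈ ballIntersection S ↔ ∀ s ∈ S, dist p s ≤ 1 := by
  simp [ballIntersection]

theorem ballIntersection_anti {S T : Set E3} (h : S ⊆ T) :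
    ballIntersection T ⊆ ballIntersection S := fun _ hp =>
  mem_ballIntersection.2 fun s hs => mem_ballIntersection.1 hp s (h hs)

theorem isClosed_ballIntersection (S : Set E3) : IsClosed (ballIntersection S) :=
  isClosed_biInter fun _ _ => Metric.isClosed_closedBall

theorem convex_ballIntersection (S : Set E3) : Convex ℝ (ballIntersection S) :=
  convex_iInter₂ fun x _ => convex_closedBall x 1

theorem isCompact_ballIntersection {S : Set E3} (hS : S.Nonempty) :
    IsCompact (ballIntersection S) := by
  obtain ⟨s, hs⟩ := hS
  exact (isCompact_closedBall s 1).of_isClosed_subset (isClosed_ballIntersection S)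
    (Set.biInter_subset_of_mem hs)

/-- If the unit ball centered at `a` has the boundary point `p`, then `p - a` supports it at `p`,
quadratically. -/
theorem inner_sub_le_of_dist_le {a p v : E3} (hp : dist p a = 1) (hv : dist v a ≤ 1) :
    inner ℝ (p - a) (v - p) ≤ -(‖v - p‖ ^ 2 / 2) := by
  rw [dist_eq_norm] at hp hv
  have h : v - a = (v - p) + (p - a) := by abel
  rw [h] at hv
  have := norm_add_sq_real (v - p) (p - a)
  rw [hp, real_inner_comm] at this
  nlinarith [norm_nonneg (v - p + (p - a))]

/-- The pushed-in point of a chord of a unit ball. -/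
theorem dist_chord_le {p s t u : E3} {τ : ℝ} (h0 : 0 ≤ τ) (h1 : τ ≤ 1) (hu : ‖u‖ = 1)
    (hp : dist p t ≤ 1) (hs : dist s t ≤ 1) :
    dist (p + τ • (s - p) + (τ * (1 - τ) * ‖s - p‖ ^ 2 / 2) • u) t ≤ 1 := by
  rw [dist_eq_norm] at *
  set c := τ * (1 - τ) * ‖s - p‖ ^ 2 with hc
  have hc0 : 0 ≤ c := by
    have : 0 ≤ 1 - τ := by linarith
    positivity
  -- Along the chord, the squared distance from t is (1−τ)|p−t|² + τ|s−t|² − τ(1−τ)|s−p|². The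
  -- defect c leaves room for a push by c/2, as √(1−c) ≤ 1 − c/2.
  have hy : ‖p + τ • (s - p) - t‖ ^ 2 ≤ 1 - c := by
    have e1 : p + τ • (s - p) - t = (p - t) + τ • (s - p) := by abel
    have e2 : s - t = (p - t) + (s - p) := by abel
    have h3 := norm_add_sq_real (p - t) (s - p)
    rw [e1, norm_add_sq_real, inner_smul_right, norm_smul, Real.norm_of_nonneg h0, hc]
    rw [e2] at hs
    have h4 : ‖p - t + (s - p)‖ ^ 2 ≤ 1 := by nlinarith [norm_nonneg (p - t + (s - p))]
    have h5 : ‖p - t‖ ^ 2 ≤ 1 := by nlinarith [norm_nonneg (p - t)]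
    nlinarith
  have hy1 : ‖p + τ • (s - p) - t‖ ≤ 1 - c / 2 := by
    have hc1 : c ≤ 1 := by nlinarith [sq_nonneg ‖p + τ • (s - p) - t‖]
    apply le_of_sq_le_sq _ (by linarith)
    nlinarith
  calc ‖p + τ • (s - p) + (c / 2) • u - t‖ = ‖(p + τ • (s - p) - t) + (c / 2) • u‖ := by
        congr 1; abel
    _ ≤ ‖p + τ • (s - p) - t‖ + ‖(c / 2) • u‖ := norm_add_le _ _
    _ ≤ 1 := by
        rw [norm_smul, hu, Real.norm_of_nonneg (by linarith)]; linarith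

/-- The chord from p to s, pushed along u as in `dist_chord_le`, stays in the ball intersection. If
s were farther than 1 from p − u, a pushed point near p would exceed p in direction u. -/
theorem dist_sub_le_of_isSupport {S : Set E3} {p u s : E3} (hu : ‖u‖ = 1)
    (hp : p ∈ ballIntersection S) (hs : s ∈ ballIntersection S)
    (hmax : ∀ z ∈ ballIntersection S, inner ℝ u z ≤ inner ℝ u p) :
    dist (p - u) s ≤ 1 := by
  by_contra! hlt
  set g := s - p with hg
  have h1 : 0 < ‖g‖ ^ 2 + 2 * inner ℝ u g := by
    have e : p - u - s = -(g + u) := by rw [hg]; abel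
    rw [dist_eq_norm, e, norm_neg] at hlt
    have := norm_add_sq_real g u
    rw [hu, real_inner_comm] at this
    nlinarith
  have hG : 0 < ‖g‖ ^ 2 := by
    by_contra! h
    have : g = 0 := by
      have : ‖g‖ = 0 := by nlinarith [norm_nonneg g]
      exact norm_eq_zero.1 this
    rw [this] at h1; simp at h1
  obtain ⟨τ, hτ0, hτ1, hτ⟩ : ∃ τ : ℝ, 0 < τ ∧ τ ≤ 1 ∧ τ * ‖g‖ ^ 2 < ‖g‖ ^ 2 + 2 * inner ℝ u g := by
    refine ⟨min 1 ((‖g‖ ^ 2 + 2 * inner ℝ u g) / (2 * ‖g‖ ^ 2)), by positivity, min_le_left _ _, ?_⟩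
    calc _ ≤ (‖g‖ ^ 2 + 2 * inner ℝ u g) / (2 * ‖g‖ ^ 2) * ‖g‖ ^ 2 := by
          gcongr; exact min_le_right _ _
      _ = (‖g‖ ^ 2 + 2 * inner ℝ u g) / 2 := by
          generalize ‖g‖ ^ 2 = G at hG ⊢; field_simp
      _ < _ := by linarith
  have hm := hmax (p + τ • (s - p) + (τ * (1 - τ) * ‖s - p‖ ^ 2 / 2) • u)
    (mem_ballIntersection.2 fun t ht => dist_chord_le hτ0.le hτ1 hu
      (mem_ballIntersection.1 hp t ht) (mem_ballIntersection.1 hs t ht))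
  rw [← hg, inner_add_right, inner_add_right, inner_smul_right, inner_smul_right,
    real_inner_self_eq_norm_sq, hu] at hm
  have : 0 < τ * (‖g‖ ^ 2 + 2 * inner ℝ u g - τ * ‖g‖ ^ 2) := by
    apply mul_pos hτ0; linarith
  nlinarith

theorem exists_isSupport {K : Set E3} (hK : IsCompact K) (hne : K.Nonempty) (u : E3) :
    ∃ p ∈ K, ∀ z ∈ K, inner ℝ u z ≤ inner ℝ u p := by
  obtain ⟨p, hp, h⟩ := hK.exists_isMaxOn hne
    (f := fun z : E3 => inner ℝ u z) (by fun_prop)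
  exact ⟨p, hp, fun z hz => h hz⟩

theorem widthInDirection_eq {K : Set E3} {u p q : E3} (hp : p ∈ K) (hq : q ∈ K)
    (hpmax : ∀ z ∈ K, inner ℝ u z ≤ inner ℝ u p) (hqmin : ∀ z ∈ K, inner ℝ u q ≤ inner ℝ u z) :
    widthInDirection K u = inner ℝ u p - inner ℝ u q := by
  have h1 : IsGreatest ((fun z => inner ℝ u z) '' K) (inner ℝ u p) :=
    ⟨⟨p, hp, rfl⟩, by rintro _ ⟨z, hz, rfl⟩; exact hpmax z hz⟩
  have h2 : IsLeast ((fun z => inner ℝ u z) '' K) (inner ℝ u q) :=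
    ⟨⟨q, hq, rfl⟩, by rintro _ ⟨z, hz, rfl⟩; exact hqmin z hz⟩
  rw [widthInDirection, h1.csSup_eq, h2.csInf_eq]

/-- A ball intersection of diameter at most one that contains its centers has constant width. -/
theorem isConstantWidth_ballIntersection {S : Set E3} (hne : S.Nonempty)
    (hS : S ⊆ ballIntersection S)
    (hdiam : ∀ p ∈ ballIntersection S, ∀ q ∈ ballIntersection S, dist p q ≤ 1) :
    IsConstantWidth (ballIntersection S) := by
  have hc := isCompact_ballIntersection hne
  have hMne : (ballIntersection S).Nonempty := hne.mono hS
  refine ⟨convex_ballIntersection S, hc, hMne, fun u hu => ?_⟩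
  obtain ⟨p, hp, hmax⟩ := exists_isSupport hc hMne u
  have hq : p - u ∈ ballIntersection S := mem_ballIntersection.2 fun s hs =>
    dist_sub_le_of_isSupport hu hp (hS hs) hmax
  have huu : inner ℝ u u = 1 := by rw [real_inner_self_eq_norm_sq, hu]; norm_num
  rw [widthInDirection_eq hp hq hmax, inner_sub_right, huu]
  · ring
  · intro z hz
    have h1 : inner ℝ u (p - z) ≤ 1 := by
      calc inner ℝ u (p - z) ≤ ‖u‖ * ‖p - z‖ := real_inner_le_norm _ _
        _ ≤ 1 := by rw [hu, one_mul, ← dist_eq_norm]; exact hdiam p hp z hz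
    rw [inner_sub_right] at h1 ⊢
    rw [huu]; linarith

/-! ### Support points of constant width bodies -/

namespace IsConstantWidth

variable {K : Set E3}

theorem inner_sub_le_one (hK : IsConstantWidth K) {u p q : E3} (hu : ‖u‖ = 1) (hp : p ∈ K)
    (hq : q ∈ K) : inner ℝ u (p - q) ≤ 1 := by
  obtain ⟨p', hp', hmax⟩ := exists_isSupport hK.isCompact hK.nonempty u
  obtain ⟨q', hq', hmin⟩ := exists_isSupport hK.isCompact hK.nonempty (-u)
  simp only [inner_neg_left, neg_le_neg_iff] at hmin
  have := hK.width_eq_one u hu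
  rw [widthInDirection_eq hp' hq' hmax hmin] at this
  rw [inner_sub_right]
  linarith [hmax p hp, hmin q hq]

theorem dist_le_one (hK : IsConstantWidth K) {p q : E3} (hp : p ∈ K) (hq : q ∈ K) :
    dist p q ≤ 1 := by
  rcases eq_or_ne p q with rfl | hne
  · simp
  have hpos : 0 < ‖p - q‖ := norm_pos_iff.2 (sub_ne_zero.2 hne)
  have := hK.inner_sub_le_one (u := (‖p - q‖)⁻¹ • (p - q)) (norm_inv_norm_smul hpos) hp hq
  rw [real_inner_smul_left, real_inner_self_eq_norm_sq] at this
  rw [dist_eq_norm]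
  field_simp at this
  exact this

/-- Equality in Cauchy–Schwarz: p − q has length at most 1 and its component along u is the width 1.
-/
theorem eq_add_of_isSupport (hK : IsConstantWidth K) {u p q : E3} (hu : ‖u‖ = 1) (hp : p ∈ K)
    (hq : q ∈ K) (hmax : ∀ z ∈ K, inner ℝ u z ≤ inner ℝ u p)
    (hmin : ∀ z ∈ K, inner ℝ (-u) z ≤ inner ℝ (-u) q) : p = q + u := by
  simp only [inner_neg_left, neg_le_neg_iff] at hmin
  have h := hK.width_eq_one u hu
  rw [widthInDirection_eq hp hq hmax hmin, ← inner_sub_right] at h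
  have hd := hK.dist_le_one hp hq
  rw [dist_eq_norm] at hd
  have h2 := norm_sub_sq_real (p - q) u
  rw [real_inner_comm, h, hu] at h2
  have h3 : ‖p - q - u‖ ^ 2 ≤ 0 := by nlinarith [norm_nonneg (p - q)]
  have h4 : p - q - u = 0 := by
    rw [← norm_eq_zero]; nlinarith [norm_nonneg (p - q - u)]
  rw [sub_sub, sub_eq_zero] at h4
  exact h4

theorem isSupport_of_dist_eq_one (hK : IsConstantWidth K) {p q : E3} (hq : q ∈ K)
    (h : dist p q = 1) : ∀ z ∈ K, inner ℝ (p - q) z ≤ inner ℝ (p - q) p := by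
  intro z hz
  have := inner_sub_le_of_dist_le h (hK.dist_le_one hz hq)
  rw [inner_sub_right] at this
  nlinarith [sq_nonneg ‖z - p‖]

/-- The support point of a constant width body in a given direction. -/
theorem exists_supportMap (hK : IsConstantWidth K) : ∃ f : E3 → E3,
    (∀ u, f u ∈ K) ∧ ∀ u, ∀ z ∈ K, inner ℝ u z ≤ inner ℝ u (f u) := by
  choose f hf using fun u => exists_isSupport hK.isCompact hK.nonempty u
  exact ⟨f, fun u => (hf u).1, fun u => (hf u).2⟩

variable {f : E3 → E3}

theorem supportMap_eq_neg_add (hK : IsConstantWidth K) (hf : ∀ u, f u ∈ K)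
    (hs : ∀ u, ∀ z ∈ K, inner ℝ u z ≤ inner ℝ u (f u)) {u : E3} (hu : ‖u‖ = 1) :
    f u = f (-u) + u :=
  hK.eq_add_of_isSupport hu (hf u) (hf (-u)) (hs u) (hs (-u))

theorem eq_supportMap (hK : IsConstantWidth K) (hf : ∀ u, f u ∈ K)
    (hs : ∀ u, ∀ z ∈ K, inner ℝ u z ≤ inner ℝ u (f u)) {u p : E3} (hu : ‖u‖ = 1) (hp : p ∈ K)
    (hmax : ∀ z ∈ K, inner ℝ u z ≤ inner ℝ u p) : p = f u := by
  rw [hK.supportMap_eq_neg_add hf hs hu]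
  exact hK.eq_add_of_isSupport hu hp (hf (-u)) hmax (hs (-u))

/-- K lies in the unit ball around the opposite support point `f (-u)`, and `f u` is on its sphere.
-/
theorem inner_supportMap_sub_le (hK : IsConstantWidth K) (hf : ∀ u, f u ∈ K)
    (hs : ∀ u, ∀ z ∈ K, inner ℝ u z ≤ inner ℝ u (f u)) {u z : E3} (hu : ‖u‖ = 1) (hz : z ∈ K) :
    inner ℝ u (z - f u) ≤ -(‖z - f u‖ ^ 2 / 2) := by
  have h := hK.supportMap_eq_neg_add hf hs hu
  have h1 : f u - f (-u) = u := by rw [h]; abel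
  have h2 : dist (f u) (f (-u)) = 1 := by rw [dist_eq_norm, h1, hu]
  have := inner_sub_le_of_dist_le h2 (hK.dist_le_one hz (hf (-u)))
  rwa [h1] at this

/-- Adding the quadratic support inequalities at u and v gives |f u − f v|² ≤ ⟨u − v, f u − f v⟩. -/
theorem norm_supportMap_sub_le (hK : IsConstantWidth K) (hf : ∀ u, f u ∈ K)
    (hs : ∀ u, ∀ z ∈ K, inner ℝ u z ≤ inner ℝ u (f u)) {u v : E3} (hu : ‖u‖ = 1)
    (hv : ‖v‖ = 1) : ‖f u - f v‖ ≤ ‖u - v‖ := by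
  have h1 := hK.inner_supportMap_sub_le hf hs hu (hf v)
  have h2 := hK.inner_supportMap_sub_le hf hs hv (hf u)
  rw [norm_sub_rev] at h1
  have h3 : inner ℝ (u - v) (f u - f v) = -inner ℝ u (f v - f u) - inner ℝ v (f u - f v) := by
    simp only [inner_sub_left, inner_sub_right]; ring
  have h4 := real_inner_le_norm (u - v) (f u - f v)
  rcases (norm_nonneg (f u - f v)).eq_or_lt with h | h
  · rw [← h]; positivity
  · nlinarith

theorem continuousOn_supportMap (hK : IsConstantWidth K) (hf : ∀ u, f u ∈ K)
    (hs : ∀ u, ∀ z ∈ K, inner ℝ u z ≤ inner ℝ u (f u)) :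
    ContinuousOn f (Metric.sphere 0 1) := by
  refine LipschitzOnWith.continuousOn (K := 1) (LipschitzOnWith.of_dist_le_mul fun u hu v hv => ?_)
  rw [dist_eq_norm, dist_eq_norm, NNReal.coe_one, one_mul]
  exact hK.norm_supportMap_sub_le hf hs (by simpa using hu) (by simpa using hv)

theorem mem_of_forall_inner_le {L : Set E3} (hL : IsConstantWidth L) {z : E3}
    (h : ∀ u : E3, ‖u‖ = 1 → ∃ y ∈ L, inner ℝ u z ≤ inner ℝ u y) : z ∈ L := by
  obtain ⟨v, hv, hmin⟩ := exists_norm_eq_iInf_of_complete_convex hL.nonempty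
    hL.isCompact.isComplete hL.convex z
  rw [norm_eq_iInf_iff_real_inner_le_zero hL.convex hv] at hmin
  by_contra hz
  have hne : z - v ≠ 0 := by rw [sub_ne_zero]; rintro rfl; exact hz hv
  have hpos : 0 < ‖z - v‖ := norm_pos_iff.2 hne
  obtain ⟨y, hy, hle⟩ := h ((‖z - v‖)⁻¹ • (z - v)) (norm_inv_norm_smul hpos)
  rw [real_inner_smul_left, real_inner_smul_left] at hle
  have hle' := le_of_mul_le_mul_left hle (inv_pos.2 hpos)
  have h1 := hmin y hy
  have h2 : inner ℝ (z - v) (z - v) = inner ℝ (z - v) z - inner ℝ (z - v) v := inner_sub_right _ _ _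
  rw [real_inner_self_eq_norm_sq] at h2
  rw [inner_sub_right] at h1
  nlinarith

end IsConstantWidth

/-! ### The criterion for extremality -/

/-- A constant width body is extreme if finitely many of its points control the others along
diameters: each boundary point is at distance one from a point which lies in the finite set `X` or
is at distance one from a point of `X`. -/
theorem isExtremeBody_of_finite {M X : Set E3} (hM : IsConstantWidth M) (hX : X.Finite)
    (hXM : X ⊆ M)
    (h : ∀ p ∈ M, ∀ u : E3, ‖u‖ = 1 → (∀ z ∈ M, inner ℝ u z ≤ inner ℝ u p) →
      ∃ s ∈ M, dist p s = 1 ∧ (s ∈ X ∨ ∃ x ∈ X, dist s x = 1)) : IsExtremeBody M := by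
  refine ⟨hM, fun t ht0 ht1 K₀ K₁ h₀ h₁ hnot hMK => hnot ?_⟩
  obtain ⟨f, hf, hfs⟩ := hM.exists_supportMap
  obtain ⟨f₀, hf₀, hfs₀⟩ := h₀.exists_supportMap
  obtain ⟨f₁, hf₁, hfs₁⟩ := h₁.exists_supportMap
  have hcomb : ∀ u : E3, ‖u‖ = 1 → f u = (1 - t) • f₀ u + t • f₁ u := fun u hu => by
    refine (hM.eq_supportMap hf hfs hu ?_ ?_).symm
    · rw [hMK]
      exact Set.add_mem_add (Set.smul_mem_smul_set (hf₀ u)) (Set.smul_mem_smul_set (hf₁ u))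
    · intro z hz
      rw [hMK] at hz
      obtain ⟨_, ⟨y₀, hy₀, rfl⟩, _, ⟨y₁, hy₁, rfl⟩, rfl⟩ := Set.mem_add.1 hz
      simp only [inner_add_right, inner_smul_right]
      have := hfs₀ u y₀ hy₀
      have := hfs₁ u y₁ hy₁
      have : 0 ≤ 1 - t := by linarith
      gcongr
  set c : E3 → E3 := fun u => f₀ u - f₁ u with hc
  have hceven : ∀ u : E3, ‖u‖ = 1 → c (-u) = c u := fun u hu => by
    simp only [hc]
    rw [h₀.supportMap_eq_neg_add hf₀ hfs₀ hu, h₁.supportMap_eq_neg_add hf₁ hfs₁ hu]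
    abel
  -- The quadratic support inequalities of both bodies, weighted by 1 − t and t, have left sides
  -- with sum zero, so both displacements vanish.
  have hcconst : ∀ u v : E3, ‖u‖ = 1 → ‖v‖ = 1 → f u = f v → c u = c v := fun u v hu hv huv => by
    rw [hcomb u hu, hcomb v hv] at huv
    have i₀ := h₀.inner_supportMap_sub_le hf₀ hfs₀ hu (hf₀ v)
    have i₁ := h₁.inner_supportMap_sub_le hf₁ hfs₁ hu (hf₁ v)
    have e : (1 - t) • (f₀ v - f₀ u) + t • (f₁ v - f₁ u) = 0 := by
      rw [smul_sub, smul_sub, ← sub_eq_zero.2 huv.symm]; abel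
    have e2 : inner ℝ u ((1 - t) • (f₀ v - f₀ u) + t • (f₁ v - f₁ u)) = 0 := by rw [e]; simp
    rw [inner_add_right, inner_smul_right, inner_smul_right] at e2
    have ht1' : 0 < 1 - t := by linarith
    have q₀ := mul_le_mul_of_nonneg_left i₀ ht1'.le
    have q₁ := mul_le_mul_of_nonneg_left i₁ ht0.le
    have p₀ : 0 ≤ (1 - t) * ‖f₀ v - f₀ u‖ ^ 2 := by positivity
    have p₁ : 0 ≤ t * ‖f₁ v - f₁ u‖ ^ 2 := by positivity
    have z₀ : (1 - t) * ‖f₀ v - f₀ u‖ ^ 2 = 0 := by linarith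
    have z₁ : t * ‖f₁ v - f₁ u‖ ^ 2 = 0 := by linarith
    have w₀ : f₀ v = f₀ u := by
      simpa [ht1'.ne', sub_eq_zero] using z₀
    have w₁ : f₁ v = f₁ u := by
      simpa [ht0.ne', sub_eq_zero] using z₁
    simp only [hc, w₀, w₁]
  have hdir : ∀ p ∈ M, ∀ q ∈ M, dist p q = 1 → p = f (p - q) ∧ ‖p - q‖ = 1 :=
    fun p hp q hq hpq => by
      have hn : ‖p - q‖ = 1 := by rwa [dist_eq_norm] at hpq
      exact ⟨hM.eq_supportMap hf hfs hn hp (hM.isSupport_of_dist_eq_one hq hpq), hn⟩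
  -- c is carried along a diameter: p − q is a normal at p, q − p is one at q, and c is even.
  have hstep : ∀ p ∈ M, ∀ q ∈ M, dist p q = 1 → ∀ u : E3, ‖u‖ = 1 → f u = p →
      ∃ v : E3, ‖v‖ = 1 ∧ f v = q ∧ c u = c v := fun p hp q hq hpq u hu hup => by
    obtain ⟨h1, h2⟩ := hdir p hp q hq hpq
    obtain ⟨h3, h4⟩ := hdir q hq p hp (by rwa [dist_comm])
    refine ⟨q - p, h4, h3.symm, ?_⟩
    rw [hcconst u (p - q) hu h2 (hup.trans h1), ← hceven _ h2, neg_sub]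
  -- The values of c at points of X, at most one for each by `hcconst`.
  set V : Set E3 := ⋃ x ∈ X, {d | ∃ v : E3, ‖v‖ = 1 ∧ f v = x ∧ d = c v} with hV
  have hVfin : V.Finite := hX.biUnion fun x _ => Set.Subsingleton.finite <| by
    rintro _ ⟨v, hv, hvx, rfl⟩ _ ⟨w, hw, hwx, rfl⟩
    exact hcconst v w hv hw (hvx.trans hwx.symm)
  have hcV : c '' Metric.sphere 0 1 ⊆ V := by
    rintro _ ⟨u, hu, rfl⟩
    have hu : ‖u‖ = 1 := by simpa using hu
    obtain ⟨s, hsM, hps, hs⟩ := h (f u) (hf u) u hu (hfs u)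
    obtain ⟨v, hv, hvs, hcv⟩ := hstep (f u) (hf u) s hsM hps u hu rfl
    rcases hs with hs | ⟨x, hx, hsx⟩
    · exact Set.mem_biUnion hs ⟨v, hv, hvs, hcv⟩
    · obtain ⟨v', hv', hvx, hcv'⟩ := hstep s hsM x (hXM hx) hsx v hv hvs
      exact Set.mem_biUnion hx ⟨v', hv', hvx, hcv.trans hcv'⟩
  have hcont : ContinuousOn c (Metric.sphere 0 1) :=
    (h₀.continuousOn_supportMap hf₀ hfs₀).sub (h₁.continuousOn_supportMap hf₁ hfs₁)
  have hconn : IsPreconnected (c '' Metric.sphere 0 1) := by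
    refine IsPreconnected.image (isPreconnected_sphere ?_ 0 1) c hcont
    rw [← Module.finrank_eq_rank]
    simp
  have hsub : (c '' Metric.sphere 0 1).Subsingleton := by
    by_contra hns
    exact (hconn.infinite_of_nontrivial (Set.not_subsingleton_iff.1 hns)) (hVfin.subset hcV)
  obtain ⟨d, hd⟩ : ∃ d, ∀ u : E3, ‖u‖ = 1 → f₀ u - f₁ u = d := by
    rcases hsub.eq_empty_or_singleton with he | ⟨d, he⟩
    · refine ⟨0, fun u hu => ?_⟩
      have : c u ∈ c '' Metric.sphere 0 1 := ⟨u, by simpa using hu, rfl⟩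
      rw [he] at this; exact this.elim
    · refine ⟨d, fun u hu => ?_⟩
      have : c u ∈ c '' Metric.sphere 0 1 := ⟨u, by simpa using hu, rfl⟩
      rw [he] at this; exact this
  refine ⟨-d, Set.Subset.antisymm (fun z hz => ⟨z + d, ?_, by simp⟩) ?_⟩
  · refine h₀.mem_of_forall_inner_le fun u hu => ⟨f₀ u, hf₀ u, ?_⟩
    have := hfs₁ u z hz
    rw [← hd u hu, inner_add_right, inner_sub_right]; linarith
  · rintro _ ⟨z, hz, rfl⟩
    refine h₁.mem_of_forall_inner_le fun u hu => ⟨f₁ u, hf₁ u, ?_⟩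
    have := hfs₀ u z hz
    simp only [← hd u hu, inner_add_right, inner_sub_right, inner_neg_right]; linarith

/-! ### Coordinates adapted to a dual pair of edges -/

/-- An orthonormal coordinate system of Euclidean three-space. -/
structure CoordFrame where
  (o f1 f2 f3 : E3)
  n1 : ‖f1‖ = 1
  n2 : ‖f2‖ = 1
  n3 : ‖f3‖ = 1
  i12 : inner ℝ f1 f2 = 0
  i13 : inner ℝ f1 f3 = 0
  i23 : inner ℝ f2 f3 = 0

namespace CoordFrame

variable (F : CoordFrame)

theorem expand (v : E3) :
    v = inner ℝ F.f1 v • F.f1 + inner ℝ F.f2 v • F.f2 + inner ℝ F.f3 v • F.f3 := by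
  have ho : Orthonormal ℝ ![F.f1, F.f2, F.f3] := by
    refine ⟨fun i => ?_, fun i j hij => ?_⟩
    · fin_cases i <;> simp [F.n1, F.n2, F.n3]
    · fin_cases i <;> fin_cases j <;>
        simp_all [F.i12, F.i13, F.i23, real_inner_comm F.f1, real_inner_comm F.f2]
  have hs := ho.linearIndependent.span_eq_top_of_card_eq_finrank' (by simp)
  have := (OrthonormalBasis.mk ho hs.ge).sum_repr' v
  rw [Fin.sum_univ_three] at this
  simpa using this.symm

theorem vec_ext {v w : E3} (h1 : inner ℝ F.f1 v = inner ℝ F.f1 w)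
    (h2 : inner ℝ F.f2 v = inner ℝ F.f2 w) (h3 : inner ℝ F.f3 v = inner ℝ F.f3 w) : v = w := by
  rw [F.expand v, F.expand w, h1, h2, h3]

theorem norm_sq (v : E3) :
    ‖v‖ ^ 2 = inner ℝ F.f1 v ^ 2 + inner ℝ F.f2 v ^ 2 + inner ℝ F.f3 v ^ 2 := by
  rw [← real_inner_self_eq_norm_sq]
  nth_rw 1 [F.expand v]
  simp only [inner_add_left, real_inner_smul_left]
  ring

/-- The first coordinate. -/
noncomputable def c1 (v : E3) : ℝ := inner ℝ F.f1 (v - F.o)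

/-- The second coordinate. -/
noncomputable def c2 (v : E3) : ℝ := inner ℝ F.f2 (v - F.o)

/-- The third coordinate. -/
noncomputable def c3 (v : E3) : ℝ := inner ℝ F.f3 (v - F.o)

theorem inner_f1_sub (v w : E3) : inner ℝ F.f1 (v - w) = F.c1 v - F.c1 w := by
  simp only [c1, inner_sub_right]; ring

theorem inner_f2_sub (v w : E3) : inner ℝ F.f2 (v - w) = F.c2 v - F.c2 w := by
  simp only [c2, inner_sub_right]; ring

theorem inner_f3_sub (v w : E3) : inner ℝ F.f3 (v - w) = F.c3 v - F.c3 w := by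
  simp only [c3, inner_sub_right]; ring

theorem continuous_c2 : Continuous F.c2 := by unfold c2; fun_prop

theorem continuous_c3 : Continuous F.c3 := by unfold c3; fun_prop

/-- The point with given coordinates. -/
def pt (s t r : ℝ) : E3 := F.o + s • F.f1 + t • F.f2 + r • F.f3

theorem pt_sub (s t r : ℝ) : F.pt s t r - F.o = s • F.f1 + t • F.f2 + r • F.f3 := by
  rw [pt]; abel

@[simp] theorem c1_pt (s t r : ℝ) : F.c1 (F.pt s t r) = s := by
  simp [c1, pt_sub, inner_add_right, inner_smul_right, F.n1, F.i12, F.i13]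

@[simp] theorem c2_pt (s t r : ℝ) : F.c2 (F.pt s t r) = t := by
  simp [c2, pt_sub, inner_add_right, inner_smul_right, F.n2, F.i12, F.i23,
    real_inner_comm F.f1 F.f2]

@[simp] theorem c3_pt (s t r : ℝ) : F.c3 (F.pt s t r) = r := by
  simp [c3, pt_sub, inner_add_right, inner_smul_right, F.n3, F.i13, F.i23,
    real_inner_comm F.f1 F.f3, real_inner_comm F.f2 F.f3]

theorem ext_coord {v w : E3} (h1 : F.c1 v = F.c1 w) (h2 : F.c2 v = F.c2 w)
    (h3 : F.c3 v = F.c3 w) : v = w := by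
  have := F.vec_ext h1 h2 h3
  simpa using this

theorem dist_sq (v w : E3) : dist v w ^ 2 =
    (F.c1 v - F.c1 w) ^ 2 + (F.c2 v - F.c2 w) ^ 2 + (F.c3 v - F.c3 w) ^ 2 := by
  rw [dist_eq_norm, F.norm_sq, inner_f1_sub, inner_f2_sub, inner_f3_sub]

theorem dist_le_one_iff (v w : E3) : dist v w ≤ 1 ↔
    (F.c1 v - F.c1 w) ^ 2 + (F.c2 v - F.c2 w) ^ 2 + (F.c3 v - F.c3 w) ^ 2 ≤ 1 := by
  rw [← F.dist_sq, sq_le_one_iff₀ dist_nonneg]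

theorem dist_eq_one_iff (v w : E3) : dist v w = 1 ↔
    (F.c1 v - F.c1 w) ^ 2 + (F.c2 v - F.c2 w) ^ 2 + (F.c3 v - F.c3 w) ^ 2 = 1 := by
  rw [← F.dist_sq, pow_eq_one_iff_of_nonneg dist_nonneg two_ne_zero]

end CoordFrame

/-- Coordinates adapted to two crossing segments `[x, y]` and `[z, w]` with
`|x - z| = |x - w| = |y - z| = |y - w| = 1`. -/
structure DualFrame (x y z w : E3) extends CoordFrame where
  (a b h : ℝ)
  a_pos : 0 < a
  b_pos : 0 < b
  h_pos : 0 < h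
  a_le : a ≤ 1 / 2
  b_le : b ≤ 1 / 2
  sq_add : a ^ 2 + b ^ 2 + h ^ 2 = 1
  x1 : toCoordFrame.c1 x = a
  x2 : toCoordFrame.c2 x = 0
  x3 : toCoordFrame.c3 x = 0
  y1 : toCoordFrame.c1 y = -a
  y2 : toCoordFrame.c2 y = 0
  y3 : toCoordFrame.c3 y = 0
  z1 : toCoordFrame.c1 z = 0
  z2 : toCoordFrame.c2 z = b
  z3 : toCoordFrame.c3 z = h
  w1 : toCoordFrame.c1 w = 0
  w2 : toCoordFrame.c2 w = -b
  w3 : toCoordFrame.c3 w = h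

/-- The four unit distances make the half-differences p, q and the vector k between the midpoints
pairwise orthogonal, with |p|² + |q|² + |k|² = 1. As |p|, |q| ≤ 1/2, also k ≠ 0, and normalizing
gives the axes. -/
theorem nonempty_dualFrame {x y z w : E3} (hxy : x ≠ y) (hzw : z ≠ w) (dxy : dist x y ≤ 1)
    (dzw : dist z w ≤ 1) (xz : dist x z = 1) (xw : dist x w = 1) (yz : dist y z = 1)
    (yw : dist y w = 1) : Nonempty (DualFrame x y z w) := by
  set p : E3 := (1 / 2 : ℝ) • (x - y) with hp
  set q : E3 := (1 / 2 : ℝ) • (z - w) with hq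
  set o : E3 := (1 / 2 : ℝ) • (x + y) with ho
  set k : E3 := (1 / 2 : ℝ) • (z + w) - o with hk
  have ex : x = o + p := by rw [ho, hp]; module
  have ey : y = o - p := by rw [ho, hp]; module
  have ez : z = o + k + q := by rw [hk, hq]; module
  have ew : w = o + k - q := by rw [hk, hq]; module
  have hp0 : 0 < ‖p‖ := by
    rw [norm_pos_iff, hp]; simpa [sub_eq_zero] using hxy
  have hq0 : 0 < ‖q‖ := by
    rw [norm_pos_iff, hq]; simpa [sub_eq_zero] using hzw
  have hp1 : ‖p‖ ≤ 1 / 2 := by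
    rw [hp, norm_smul, ← dist_eq_norm, Real.norm_of_nonneg (by norm_num)]; linarith
  have hq1 : ‖q‖ ≤ 1 / 2 := by
    rw [hq, norm_smul, ← dist_eq_norm, Real.norm_of_nonneg (by norm_num)]; linarith
  have key : ∀ s t : E3, dist s t = 1 → ∀ v, s - t = v → inner ℝ v v = 1 := by
    rintro s t hst v rfl
    rw [real_inner_self_eq_norm_sq, ← dist_eq_norm, hst, one_pow]
  have k1 := key x z xz (p - k - q) (by rw [ex, ez]; abel)
  have k2 := key x w xw (p - k + q) (by rw [ex, ew]; abel)
  have k3 := key y z yz (-p - k - q) (by rw [ey, ez]; abel)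
  have k4 := key y w yw (-p - k + q) (by rw [ey, ew]; abel)
  simp only [inner_sub_left, inner_sub_right, inner_add_left, inner_add_right, inner_neg_left,
    inner_neg_right, real_inner_comm p k, real_inner_comm q k, real_inner_comm p q] at k1 k2 k3 k4
  have ipq : inner ℝ p q = 0 := by linarith
  have ipk : inner ℝ p k = 0 := by linarith
  have iqk : inner ℝ q k = 0 := by linarith
  have hsum : ‖p‖ ^ 2 + ‖q‖ ^ 2 + ‖k‖ ^ 2 = 1 := by
    simp only [← real_inner_self_eq_norm_sq]
    linarith
  have hk0 : 0 < ‖k‖ := by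
    rcases (norm_nonneg k).eq_or_lt with h | h
    · rw [← h] at hsum; nlinarith
    · exact h
  have iqp : inner ℝ q p = 0 := by rwa [real_inner_comm]
  have ikp : inner ℝ k p = 0 := by rwa [real_inner_comm]
  have ikq : inner ℝ k q = 0 := by rwa [real_inner_comm]
  let F : CoordFrame :=
    { o := o, f1 := (‖p‖)⁻¹ • p, f2 := (‖q‖)⁻¹ • q, f3 := (‖k‖)⁻¹ • k
      n1 := norm_inv_norm_smul hp0
      n2 := norm_inv_norm_smul hq0
      n3 := norm_inv_norm_smul hk0
      i12 := by rw [real_inner_smul_left, inner_smul_right, ipq]; simp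
      i13 := by rw [real_inner_smul_left, inner_smul_right, ipk]; simp
      i23 := by rw [real_inner_smul_left, inner_smul_right, iqk]; simp }
  have e1 : ∀ v, F.c1 v = (‖p‖)⁻¹ * inner ℝ p (v - o) := fun v => real_inner_smul_left _ _ _
  have e2 : ∀ v, F.c2 v = (‖q‖)⁻¹ * inner ℝ q (v - o) := fun v => real_inner_smul_left _ _ _
  have e3 : ∀ v, F.c3 v = (‖k‖)⁻¹ * inner ℝ k (v - o) := fun v => real_inner_smul_left _ _ _
  have sx : x - o = p := by rw [ex]; abel
  have sy : y - o = -p := by rw [ey]; abel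
  have sz : z - o = k + q := by rw [ez]; abel
  have sw : w - o = k - q := by rw [ew]; abel
  have hpp : (‖p‖)⁻¹ * ‖p‖ ^ 2 = ‖p‖ := by field_simp
  have hqq : (‖q‖)⁻¹ * ‖q‖ ^ 2 = ‖q‖ := by field_simp
  have hkk : (‖k‖)⁻¹ * ‖k‖ ^ 2 = ‖k‖ := by field_simp
  refine ⟨{ toCoordFrame := F, a := ‖p‖, b := ‖q‖, h := ‖k‖, a_pos := hp0, b_pos := hq0
            h_pos := hk0, a_le := hp1, b_le := hq1, sq_add := hsum
            x1 := ?_, x2 := ?_, x3 := ?_, y1 := ?_, y2 := ?_, y3 := ?_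
            z1 := ?_, z2 := ?_, z3 := ?_, w1 := ?_, w2 := ?_, w3 := ?_ }⟩ <;>
  simp only [e1, e2, e3, sx, sy, sz, sw, inner_add_right, inner_sub_right, inner_neg_right,
    real_inner_self_eq_norm_sq, ipq, ipk, iqk, iqp, ikp, ikq, neg_zero, mul_zero, add_zero,
    zero_add, sub_zero, zero_sub, mul_neg, hpp, hqq, hkk]

namespace DualFrame

variable {x y z w : E3} (F : DualFrame x y z w)

/-- The same coordinates, with the roles of the two segments exchanged. -/
noncomputable def swap : DualFrame z w x y where
  o := F.o + F.h • F.f3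
  f1 := F.f2
  f2 := F.f1
  f3 := -F.f3
  n1 := F.n2
  n2 := F.n1
  n3 := by rw [norm_neg, F.n3]
  i12 := by rw [real_inner_comm, F.i12]
  i13 := by rw [inner_neg_right, F.i23, neg_zero]
  i23 := by rw [inner_neg_right, F.i13, neg_zero]
  a := F.b
  b := F.a
  h := F.h
  a_pos := F.b_pos
  b_pos := F.a_pos
  h_pos := F.h_pos
  a_le := F.b_le
  b_le := F.a_le
  sq_add := by linarith [F.sq_add]
  x1 := by
    have := F.z2
    simp_all [CoordFrame.c1, CoordFrame.c2, ← sub_sub, inner_sub_right, inner_smul_right, F.i23]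
  x2 := by
    have := F.z1
    simp_all [CoordFrame.c1, CoordFrame.c2, ← sub_sub, inner_sub_right, inner_smul_right, F.i13]
  x3 := by
    have := F.z3
    simp_all [CoordFrame.c3, ← sub_sub, inner_sub_right, inner_smul_right, F.n3]
    linarith
  y1 := by
    have := F.w2
    simp_all [CoordFrame.c1, CoordFrame.c2, ← sub_sub, inner_sub_right, inner_smul_right, F.i23]
  y2 := by
    have := F.w1
    simp_all [CoordFrame.c1, CoordFrame.c2, ← sub_sub, inner_sub_right, inner_smul_right, F.i13]
  y3 := by
    have := F.w3
    simp_all [CoordFrame.c3, ← sub_sub, inner_sub_right, inner_smul_right, F.n3]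
    linarith
  z1 := by
    have := F.x2
    simp_all [CoordFrame.c1, CoordFrame.c2, ← sub_sub, inner_sub_right, inner_smul_right, F.i23]
  z2 := by
    have := F.x1
    simp_all [CoordFrame.c1, CoordFrame.c2, ← sub_sub, inner_sub_right, inner_smul_right, F.i13]
  z3 := by
    have := F.x3
    simp_all [CoordFrame.c3, ← sub_sub, inner_sub_right, inner_smul_right, F.n3]
    linarith
  w1 := by
    have := F.y2
    simp_all [CoordFrame.c1, CoordFrame.c2, ← sub_sub, inner_sub_right, inner_smul_right, F.i23]
  w2 := by
    have := F.y1
    simp_all [CoordFrame.c1, CoordFrame.c2, ← sub_sub, inner_sub_right, inner_smul_right, F.i13]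
  w3 := by
    have := F.y3
    simp_all [CoordFrame.c3, ← sub_sub, inner_sub_right, inner_smul_right, F.n3]
    linarith

/-- The same coordinates, with the endpoints of the second segment exchanged. -/
noncomputable def flip : DualFrame x y w z where
  o := F.o
  f1 := F.f1
  f2 := -F.f2
  f3 := F.f3
  n1 := F.n1
  n2 := by rw [norm_neg, F.n2]
  n3 := F.n3
  i12 := by rw [inner_neg_right, F.i12, neg_zero]
  i13 := F.i13
  i23 := by rw [inner_neg_left, F.i23, neg_zero]
  a := F.a
  b := F.b
  h := F.h
  a_pos := F.a_pos
  b_pos := F.b_pos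
  h_pos := F.h_pos
  a_le := F.a_le
  b_le := F.b_le
  sq_add := F.sq_add
  x1 := F.x1
  x2 := by have := F.x2; simp_all [CoordFrame.c2]
  x3 := F.x3
  y1 := F.y1
  y2 := by have := F.y2; simp_all [CoordFrame.c2]
  y3 := F.y3
  z1 := F.w1
  z2 := by have := F.w2; simp_all [CoordFrame.c2]
  z3 := F.w3
  w1 := F.z1
  w2 := by have := F.z2; simp_all [CoordFrame.c2]
  w3 := F.z3

theorem swap_c1 (v : E3) : F.swap.c1 v = F.c2 v := by
  simp [swap, CoordFrame.c1, CoordFrame.c2, ← sub_sub, inner_sub_right, inner_smul_right, F.i23]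

theorem swap_c2 (v : E3) : F.swap.c2 v = F.c1 v := by
  simp [swap, CoordFrame.c1, CoordFrame.c2, ← sub_sub, inner_sub_right, inner_smul_right, F.i13]

theorem swap_c3 (v : E3) : F.swap.c3 v = F.h - F.c3 v := by
  simp [swap, CoordFrame.c3, ← sub_sub, inner_sub_right, inner_smul_right, F.n3]
  ring

theorem flip_c2 (v : E3) : F.flip.c2 v = -F.c2 v := by
  simp [flip, CoordFrame.c2]

/-! ### Metric properties of the arcs -/

/-- The open arc from `z` to `w` of the circle on the unit spheres around `x` and `y`. -/
def arc : Set E3 :=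
  {v | F.c1 v = 0 ∧ F.c2 v ^ 2 + F.c3 v ^ 2 = F.b ^ 2 + F.h ^ 2 ∧ F.h < F.c3 v}

theorem mem_swap_arc {v : E3} : v ∈ F.swap.arc ↔
    F.c2 v = 0 ∧ F.c1 v ^ 2 + (F.h - F.c3 v) ^ 2 = F.a ^ 2 + F.h ^ 2 ∧ F.c3 v < 0 := by
  simp only [arc, Set.mem_ofPred_eq, swap_c1, swap_c2, swap_c3]
  rw [show F.swap.h = F.h from rfl, show F.swap.b = F.a from rfl]
  constructor <;> rintro ⟨h1, h2, h3⟩ <;> exact ⟨h1, h2, by linarith⟩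

theorem flip_swap_arc : F.flip.swap.arc = F.swap.arc := by
  ext v
  rw [mem_swap_arc, mem_swap_arc, flip_c2, neg_eq_zero]
  rfl

theorem flip_arc : F.flip.arc = F.arc := by
  ext v
  simp only [arc, Set.mem_ofPred_eq, flip_c2, neg_sq]
  rfl

theorem dist_x_of_mem {v : E3} (hv : v ∈ F.arc) : dist v x = 1 := by
  obtain ⟨h1, h2, -⟩ := hv
  rw [F.dist_eq_one_iff, F.x1, F.x2, F.x3, h1]
  nlinarith [F.sq_add]

theorem dist_xz (F : DualFrame x y z w) : dist x z = 1 := by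
  rw [F.dist_eq_one_iff, F.x1, F.x2, F.x3, F.z1, F.z2, F.z3]
  nlinarith [F.sq_add]

theorem dist_yz (F : DualFrame x y z w) : dist y z = 1 := by
  rw [F.dist_eq_one_iff, F.y1, F.y2, F.y3, F.z1, F.z2, F.z3]
  nlinarith [F.sq_add]

/-- The squared distance is 1 + 2(c3 q − h)(−c3 p), with both factors positive. This removes every
point of a dual edge from the Meissner polyhedron. -/
theorem one_lt_dist {q p : E3} (hq : q ∈ F.arc) (hp : p ∈ F.swap.arc) : 1 < dist q p := by
  obtain ⟨q1, q2, q3⟩ := hq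
  obtain ⟨p1, p2, p3⟩ := F.mem_swap_arc.1 hp
  rw [← one_lt_sq_iff₀ dist_nonneg, F.dist_sq, q1, p1]
  nlinarith [F.sq_add, mul_pos (sub_pos.2 q3) (neg_pos.2 p3)]

theorem abs_c2_lt {v : E3} (hv : v ∈ F.arc) : |F.c2 v| < F.b := by
  obtain ⟨-, h2, h3⟩ := hv
  refine abs_lt_of_sq_lt_sq ?_ F.b_pos.le
  nlinarith [F.h_pos]

theorem eq_of_c2_eq {v v' : E3} (hv : v ∈ F.arc) (hv' : v' ∈ F.arc) (h : F.c2 v = F.c2 v') :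
    v = v' := by
  obtain ⟨a1, a2, a3⟩ := hv
  obtain ⟨b1, b2, b3⟩ := hv'
  refine F.ext_coord (a1.trans b1.symm) h ?_
  rw [h] at a2
  have := F.h_pos
  have h0 : 0 ≤ F.c3 v := by linarith
  have h0' : 0 ≤ F.c3 v' := by linarith
  rw [← sq_eq_sq₀ h0 h0']
  linarith

/-- A linear function that is minimal at a point of the open arc is radial there. -/
theorem exists_radial {q : E3} (hq : q ∈ F.arc) {A B : ℝ}
    (hmin : ∀ v ∈ F.arc, A * F.c2 q + B * F.c3 q ≤ A * F.c2 v + B * F.c3 v) :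
    ∃ l : ℝ, 0 ≤ l ∧ A = -l * F.c2 q ∧ B = -l * F.c3 q := by
  obtain ⟨h1, h2, h3⟩ := hq
  set s := F.c2 q
  set c := F.c3 q
  have hh := F.h_pos
  have hb := F.b_pos
  set P := A * s + B * c with hP
  set Q := B * s - A * c with hQ
  -- Rotations whose half-angle tangent is at most δ in absolute value keep q above height h.
  set δ := (c - F.h) / (2 * (c + F.h + 2 * |s|)) with hδ
  have hc0 : 0 < c := hh.trans h3
  have hD : 0 < c + F.h + 2 * |s| := by positivity
  have hδ0 : 0 < δ := by
    have : 0 < c - F.h := by linarith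
    positivity
  have hδ1 : δ ≤ 1 := by
    rw [hδ, div_le_one (by positivity)]
    have := abs_nonneg s
    linarith
  -- Compares q with its rotation by the angle of half-angle tangent t. Taking t = ±δ gives P ≤ 0,
  -- and letting t be small gives Q = 0.
  have key : ∀ t : ℝ, |t| ≤ δ → t ^ 2 * P ≤ t * Q := by
    intro t ht
    have ht1 : 0 < 1 + t ^ 2 := by positivity
    have hmem : F.pt 0 (((1 - t ^ 2) * s - 2 * t * c) / (1 + t ^ 2))
        (((1 - t ^ 2) * c + 2 * t * s) / (1 + t ^ 2)) ∈ F.arc := by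
      refine ⟨F.c1_pt _ _ _, ?_, ?_⟩
      · rw [F.c2_pt, F.c3_pt, ← h2]
        field_simp
        ring
      · rw [F.c3_pt, lt_div_iff₀ ht1]
        have e1 : δ * (2 * (c + F.h + 2 * |s|)) = c - F.h := by rw [hδ]; field_simp
        have e2 : -(t * s) ≤ |t| * |s| := by rw [← abs_mul]; exact neg_le_abs _
        have e3 : t ^ 2 ≤ |t| := by
          rw [← sq_abs]; nlinarith [abs_nonneg t]
        have e4 : |t| * |s| ≤ δ * |s| := by gcongr
        have e5 : t ^ 2 * (c + F.h) ≤ δ * (c + F.h) := by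
          have : 0 < c + F.h := by linarith
          gcongr; linarith
        nlinarith [mul_pos hδ0 hD]
    have := hmin _ hmem
    rw [F.c2_pt, F.c3_pt] at this
    have e : A * (((1 - t ^ 2) * s - 2 * t * c) / (1 + t ^ 2)) +
        B * (((1 - t ^ 2) * c + 2 * t * s) / (1 + t ^ 2)) =
        ((1 - t ^ 2) * P + 2 * t * Q) / (1 + t ^ 2) := by
      rw [hP, hQ]; ring
    rw [e, le_div_iff₀ ht1] at this
    linarith
  have hP0 : P ≤ 0 := by
    have k1 := key δ (abs_of_pos hδ0).le
    have k2 := key (-δ) (by rw [abs_neg, abs_of_pos hδ0])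
    have : 0 < δ ^ 2 := by positivity
    nlinarith
  have hQ0 : Q = 0 := by
    by_contra hne
    have hQp : 0 < |Q| := abs_pos.2 hne
    have : ∀ t : ℝ, 0 < t → t ≤ δ → t * P ≤ -|Q| := by
      intro t ht0 ht
      have k1 := key t (by rwa [abs_of_pos ht0])
      have k2 := key (-t) (by rwa [abs_neg, abs_of_pos ht0])
      rcases abs_cases Q with ⟨e, -⟩ | ⟨e, -⟩ <;> rw [e] <;> nlinarith
    obtain ⟨m, hm0, hm1, hm2⟩ : ∃ m, 0 < m ∧ m ≤ δ ∧ m * |P| ≤ |Q| / 2 := by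
      refine ⟨min δ (|Q| / (2 * (|P| + 1))), by positivity, min_le_left _ _, ?_⟩
      calc _ ≤ |Q| / (2 * (|P| + 1)) * |P| := by gcongr; exact min_le_right _ _
        _ ≤ |Q| / 2 := by
          rw [div_mul_eq_mul_div, div_le_div_iff₀ (by positivity) (by positivity)]
          nlinarith
    have k := this m hm0 hm1
    rw [abs_of_nonpos hP0] at hm2
    linarith
  have hr : 0 < s ^ 2 + c ^ 2 := by rw [h2]; positivity
  refine ⟨-P / (s ^ 2 + c ^ 2), div_nonneg (by linarith) hr.le, ?_, ?_⟩
  · field_simp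
    rw [hP]; rw [hQ] at hQ0; linear_combination (-c) * hQ0
  · field_simp
    rw [hP]; rw [hQ] at hQ0; linear_combination s * hQ0

/-- The farthest point on the arc from `p` sees `p` between `x` and `y`. -/
theorem exists_cone_of_farthest {q p : E3} (hq : q ∈ F.arc) (hz : dist p z ≤ 1)
    (hw : dist p w ≤ 1) (hmax : ∀ v ∈ F.arc, dist p v ≤ dist p q) (h1 : 1 ≤ dist p q)
    (hx : p ≠ x) (hy : p ≠ y) :
    ∃ α β : ℝ, 0 < α ∧ 0 < β ∧ 1 < α + β ∧ q - p = α • (q - x) + β • (q - y) := by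
  have hq' := hq
  obtain ⟨a1, a2, a3⟩ := hq
  -- On the arc the squared distance from p is a constant minus twice this linear function. So the
  -- projection of p to the plane of the arc is −l times q, measured from the midpoint of x and y.
  obtain ⟨l, hl, l2, l3⟩ := F.exists_radial hq' (A := F.c2 p) (B := F.c3 p) (fun v hv => by
    have := hmax v hv
    rw [← sq_le_sq₀ dist_nonneg dist_nonneg, F.dist_sq, F.dist_sq, a1, hv.1] at this
    nlinarith [hv.2.1])
  have hh := F.h_pos
  have hb := F.b_pos
  have ha := F.a_pos
  rw [← one_le_sq_iff₀ dist_nonneg, F.dist_sq, l2, l3, a1] at h1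
  rw [F.dist_le_one_iff, F.z1, F.z2, F.z3, l2, l3] at hz
  rw [F.dist_le_one_iff, F.w1, F.w2, F.w3, l2, l3] at hw
  have hs := F.sq_add
  -- If l = 0, then p is on the line through x and y, and the bounds at q and z force p = x or p =
  -- y.
  have hl0 : 0 < l := by
    rcases hl.eq_or_lt with h0 | h0
    · exfalso
      rw [← h0] at h1 hz l2 l3
      have : F.c1 p ^ 2 = F.a ^ 2 := by nlinarith
      rcases sq_eq_sq_iff_eq_or_eq_neg.1 this with h | h
      · exact hx (F.ext_coord (by rw [h, F.x1]) (by rw [l2, F.x2]; simp) (by rw [l3, F.x3]; simp))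
      · exact hy (F.ext_coord (by rw [h, F.y1]) (by rw [l2, F.y2]; simp) (by rw [l3, F.y3]; simp))
    · exact h0
  -- Adding the bounds at z and w cancels the terms linear in b.
  have hlt : F.c1 p ^ 2 < F.a ^ 2 := by
    have m1 : 0 < l * (F.h * F.c3 q) := by
      have : 0 < F.c3 q := by linarith
      positivity
    have m2 : l ^ 2 * (F.c2 q ^ 2 + F.c3 q ^ 2) = l ^ 2 * (F.b ^ 2 + F.h ^ 2) := by rw [a2]
    have m3 : 0 ≤ l ^ 2 * (F.b ^ 2 + F.h ^ 2) := by positivity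
    linarith [hz, hw, m1, m2, m3, hs]
  have habs := abs_lt_of_sq_lt_sq hlt ha.le
  rw [abs_lt] at habs
  set k := F.c1 p / F.a with hk
  have hk1 : k < 1 := by rw [hk, div_lt_one ha]; exact habs.2
  have hk2 : -1 < k := by rw [hk, lt_div_iff₀ ha]; linarith
  have hka : k * F.a = F.c1 p := by rw [hk]; field_simp
  -- α + β = 1 + l matches the components in the plane of the arc, α − β = k the axial one.
  refine ⟨(1 + l + k) / 2, (1 + l - k) / 2, by linarith, by linarith, by linarith, ?_⟩
  refine F.vec_ext ?_ ?_ ?_ <;>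
  simp only [inner_add_right, inner_smul_right, F.inner_f1_sub, F.inner_f2_sub, F.inner_f3_sub,
    F.x1, F.x2, F.x3, F.y1, F.y2, F.y3, a1, l2, l3]
  · rw [← hka]; ring
  · ring
  · ring

/-- A unit ball that touches the arc from outside at an interior point contains the lens
of the unit balls around `x` and `y`. -/
theorem lens_subset {q c : E3} (hq : q ∈ F.arc) (hc : dist c q = 1)
    (hle : ∀ v ∈ F.arc, dist c v ≤ 1) {v : E3} (hx : dist v x ≤ 1) (hy : dist v y ≤ 1) :
    dist v c ≤ 1 := by
  have hq' := hq
  obtain ⟨a1, a2, a3⟩ := hq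
  obtain ⟨l, hl, l2, l3⟩ := F.exists_radial hq' (A := F.c2 c) (B := F.c3 c) (fun v hv => by
    have := hle v hv
    rw [← hc, ← sq_le_sq₀ dist_nonneg dist_nonneg, F.dist_sq, F.dist_sq, a1, hv.1] at this
    nlinarith [hv.2.1])
  have ha := F.a_pos
  have hs := F.sq_add
  rw [F.dist_eq_one_iff, l2, l3, a1] at hc
  rw [F.dist_le_one_iff, F.x1, F.x2, F.x3] at hx
  rw [F.dist_le_one_iff, F.y1, F.y2, F.y3] at hy
  rw [F.dist_le_one_iff, l2, l3]
  set R := F.b ^ 2 + F.h ^ 2 with hR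
  have hR0 : 0 ≤ R := by positivity
  have m : l ^ 2 * (F.c2 q ^ 2 + F.c3 q ^ 2) = l ^ 2 * R := by rw [a2]
  have m' : l * (F.c2 q ^ 2 + F.c3 q ^ 2) = l * R := by rw [a2]
  -- |c − q| = 1 reads c1² + (1 + l)²R = a² + R: the axial coordinate of c is between those of x and
  -- y.
  have hc1 : F.c1 c ^ 2 ≤ F.a ^ 2 := by nlinarith
  have hc1' : |F.c1 c| ≤ F.a := abs_le_of_sq_le_sq hc1 ha.le
  have hv0 : 0 ≤ |F.c1 v| := abs_nonneg _
  have hv1 : F.c1 v ^ 2 + F.c2 v ^ 2 + F.c3 v ^ 2 + 2 * F.a * |F.c1 v| ≤ R := by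
    rcases abs_cases (F.c1 v) with ⟨e, -⟩ | ⟨e, -⟩ <;> rw [e] <;> nlinarith
  have e1 : -(F.c1 v * F.c1 c) ≤ |F.c1 v| * F.a := by
    calc _ ≤ |F.c1 v * F.c1 c| := neg_le_abs _
      _ = |F.c1 v| * |F.c1 c| := abs_mul _ _
      _ ≤ _ := by gcongr
  have e2 : F.c2 v * F.c2 q + F.c3 v * F.c3 q ≤ R := by
    nlinarith [sq_nonneg (F.c2 v - F.c2 q), sq_nonneg (F.c3 v - F.c3 q), sq_nonneg (F.c1 v)]
  have e3 := mul_le_mul_of_nonneg_left e2 hl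
  nlinarith

end DualFrame

/-! ### Edges as arcs, and the normals along them -/

/-- As the coefficient sum is at least 1, the quadratic support inequalities of the three balls at z
add up to that of the unit ball around z − u. -/
theorem dist_sub_le_of_cone {x y p z t u : E3} {A B C : ℝ} (hA : 0 ≤ A) (hB : 0 ≤ B) (hC : 0 ≤ C)
    (hABC : 1 ≤ A + B + C) (hu : ‖u‖ = 1) (e : u = A • (z - x) + B • (z - y) + C • (z - p))
    (zx : dist z x = 1) (zy : dist z y = 1) (zp : dist z p = 1)
    (tx : dist t x ≤ 1) (ty : dist t y ≤ 1) (tp : dist t p ≤ 1) : dist (z - u) t ≤ 1 := by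
  have k1 := mul_le_mul_of_nonneg_left (inner_sub_le_of_dist_le zx tx) hA
  have k2 := mul_le_mul_of_nonneg_left (inner_sub_le_of_dist_le zy ty) hB
  have k3 := mul_le_mul_of_nonneg_left (inner_sub_le_of_dist_le zp tp) hC
  have hk : inner ℝ u (t - z) ≤ -(‖t - z‖ ^ 2 / 2) := by
    rw [e]
    simp only [inner_add_left, real_inner_smul_left]
    nlinarith [sq_nonneg ‖t - z‖]
  have e1 : z - u - t = -((t - z) + u) := by abel
  have h2 := norm_add_sq_real (t - z) u
  rw [real_inner_comm, hu] at h2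
  rw [dist_eq_norm, e1, norm_neg, ← sq_le_one_iff₀ (norm_nonneg _), h2]
  linarith

theorem IsPreconnected.lt_or_gt_of_forall_ne {s : Set E3} (hs : IsPreconnected s) {f : E3 → ℝ}
    (hf : Continuous f) {k : ℝ} (hne : ∀ v ∈ s, f v ≠ k) :
    (∀ v ∈ s, f v < k) ∨ ∀ v ∈ s, k < f v := by
  by_contra! h
  obtain ⟨⟨v, hv, h1⟩, ⟨w, hw, h2⟩⟩ := h
  obtain ⟨u, hu, hk⟩ := hs.intermediate_value hw hv hf.continuousOn ⟨h2, h1⟩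
  exact hne u hu hk

namespace DualFrame

variable {x y z w : E3}

/-- An edge with centers `x`, `y` and endpoints `z`, `w` is the short open arc. -/
theorem edge_eq_arc (F : DualFrame x y z w) {X e : Set E3} (he : IsEdgeOn X x y e)
    (hends : HasEndpoints e z w) (hz : z ∈ X) (hw : w ∈ X) : e = F.arc := by
  obtain ⟨-, -, -, p, -, rfl⟩ := he
  obtain ⟨-, hcl⟩ := hends
  set e := connectedComponentIn (edgeLocus X x y) p
  have hconn : IsPreconnected e := isPreconnected_connectedComponentIn
  have hsub : e ⊆ edgeLocus X x y := connectedComponentIn_subset _ _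
  have hzc : z ∈ closure e := by
    have : z ∈ closure e \ e := by rw [hcl]; simp
    exact this.1
  have hwc : w ∈ closure e := by
    have : w ∈ closure e \ e := by rw [hcl]; simp
    exact this.1
  have hR := F.sq_add
  have ha := F.a_pos
  have hb := F.b_pos
  have hh := F.h_pos
  have ha' := F.a_le
  have circ : ∀ v ∈ e, F.c1 v = 0 ∧ F.c2 v ^ 2 + F.c3 v ^ 2 = F.b ^ 2 + F.h ^ 2 := by
    intro v hv
    obtain ⟨⟨⟨h1, h2⟩, -⟩, -⟩ := hsub hv
    rw [Metric.mem_sphere, F.dist_eq_one_iff, F.x1, F.x2, F.x3] at h1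
    rw [Metric.mem_sphere, F.dist_eq_one_iff, F.y1, F.y2, F.y3] at h2
    have h0 : F.c1 v * F.a = 0 := by linarith
    have h0 : F.c1 v = 0 := by
      rcases mul_eq_zero.1 h0 with h | h
      · exact h
      · exact absurd h ha.ne'
    rw [h0] at h1
    exact ⟨h0, by linarith⟩
  -- z and w are the only points of the circle at height h, and they belong to X.
  have ne_h : ∀ v ∈ e, F.c3 v ≠ F.h := by
    intro v hv h3
    obtain ⟨h1, h2⟩ := circ v hv
    rw [h3] at h2
    have : F.c2 v ^ 2 = F.b ^ 2 := by linarith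
    rcases sq_eq_sq_iff_eq_or_eq_neg.1 this with h | h
    · exact (hsub hv).2 (F.ext_coord (h1.trans F.z1.symm) (h.trans F.z2.symm)
        (h3.trans F.z3.symm) ▸ hz)
    · exact (hsub hv).2 (F.ext_coord (h1.trans F.w1.symm) (h.trans F.w2.symm)
        (h3.trans F.w3.symm) ▸ hw)
  have above : ∀ v ∈ e, F.h < F.c3 v := by
    rcases hconn.lt_or_gt_of_forall_ne F.continuous_c3 ne_h with hlt | hgt
    swap
    · exact hgt
    exfalso
    -- This excludes the complementary arc: its lowest point is farther than 1 from z, so e would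
    -- stay on one side of it and could not approach both z and w.
    have ne0 : ∀ v ∈ e, F.c2 v ≠ 0 := by
      intro v hv h0
      obtain ⟨h1, h2⟩ := circ v hv
      have h4 := mem_ballIntersection.1 (hsub hv).1.2 z hz
      rw [F.dist_le_one_iff, F.z1, F.z2, F.z3, h1, h0] at h4
      rw [h0] at h2
      have h5 := hlt v hv
      have h6 : F.c3 v < 0 := by nlinarith
      nlinarith
    rcases hconn.lt_or_gt_of_forall_ne F.continuous_c2 ne0 with h | h
    · have := closure_minimal (fun v hv => (h v hv).le)
        (isClosed_le F.continuous_c2 continuous_const) hzc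
      have : F.c2 z ≤ 0 := this
      rw [F.z2] at this; linarith
    · have := closure_minimal (fun v hv => (h v hv).le)
        (isClosed_le continuous_const F.continuous_c2) hwc
      have : 0 ≤ F.c2 w := this
      rw [F.w2] at this; linarith
  have hsub' : e ⊆ F.arc := fun v hv => ⟨(circ v hv).1, (circ v hv).2, above v hv⟩
  refine hsub'.antisymm fun v hv => ?_
  -- Conversely, on e the second coordinate takes all values between −b and b, and it determines the
  -- point of the arc.
  have hv2 := abs_lt.1 (F.abs_c2_lt hv)
  obtain ⟨v₁, h₁, hv₁⟩ := mem_closure_iff.1 hzc {t | F.c2 v < F.c2 t}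
    (isOpen_lt continuous_const F.continuous_c2) (by rw [Set.mem_ofPred_eq, F.z2]; exact hv2.2)
  obtain ⟨v₂, h₂, hv₂⟩ := mem_closure_iff.1 hwc {t | F.c2 t < F.c2 v}
    (isOpen_lt F.continuous_c2 continuous_const) (by rw [Set.mem_ofPred_eq, F.w2]; exact hv2.1)
  obtain ⟨v', hv', hvv⟩ := hconn.intermediate_value hv₂ hv₁ F.continuous_c2.continuousOn
    ⟨le_of_lt h₂, le_of_lt h₁⟩
  rwa [F.eq_of_c2_eq hv (hsub' hv') hvv.symm]

/-- Coordinates of the unit outer normals along the open arc, and the scaling factor that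
projects them to the dual arc. -/
theorem normal_coords (F : DualFrame x y z w) {q u : E3} (hq : q ∈ F.arc) {α β : ℝ} (hα : 0 < α)
    (hβ : 0 < β) (hu : u = α • (q - x) + β • (q - y)) (hn : ‖u‖ = 1) :
    0 < inner ℝ F.f3 u ∧ F.h * |inner ℝ F.f2 u| < F.b * inner ℝ F.f3 u ∧
      F.h * |inner ℝ F.f1 u| ≤ F.a * inner ℝ F.f3 u ∧
      ∃ k : ℝ, 0 < k ∧ F.h < k * inner ℝ F.f3 u ∧
        k ^ 2 * (1 - inner ℝ F.f2 u ^ 2) = 1 - F.b ^ 2 ∧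
        F.pt (-(k * inner ℝ F.f1 u)) 0 (F.h - k * inner ℝ F.f3 u) ∈ F.swap.arc := by
  have hq' := hq
  obtain ⟨q1, q2, q3⟩ := hq
  have hR := F.sq_add
  have ha := F.a_pos
  have hb := F.b_pos
  have hh := F.h_pos
  have hs := F.norm_sq u
  have e1 : inner ℝ F.f1 u = F.a * (β - α) := by
    rw [hu]
    simp only [inner_add_right, inner_smul_right, F.inner_f1_sub, F.x1, F.y1, q1]; ring
  have e2 : inner ℝ F.f2 u = (α + β) * F.c2 q := by
    rw [hu]
    simp only [inner_add_right, inner_smul_right, F.inner_f2_sub, F.x2, F.y2]; ring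
  have e3 : inner ℝ F.f3 u = (α + β) * F.c3 q := by
    rw [hu]
    simp only [inner_add_right, inner_smul_right, F.inner_f3_sub, F.x3, F.y3]; ring
  rw [hn] at hs
  have hb2 := F.abs_c2_lt hq'
  set u1 := inner ℝ F.f1 u
  set u2 := inner ℝ F.f2 u
  set u3 := inner ℝ F.f3 u
  have hc : 0 < F.c3 q := by linarith
  have hαβ : 0 < α + β := by linarith
  have u3pos : 0 < u3 := by rw [e3]; positivity
  have h2 : F.h * |u2| < F.b * u3 := by
    rw [e2, e3, abs_mul, abs_of_pos hαβ]
    have : F.h * |F.c2 q| < F.b * F.c3 q := by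
      calc F.h * |F.c2 q| < F.h * F.b := by gcongr
        _ < F.b * F.c3 q := by rw [mul_comm]; gcongr
    have := mul_lt_mul_of_pos_left this hαβ
    linarith
  have h2sq : F.h ^ 2 * u2 ^ 2 < F.b ^ 2 * u3 ^ 2 := by
    rw [← mul_pow, ← mul_pow, ← sq_abs (F.h * u2), abs_mul, abs_of_pos hh]
    gcongr
  have h1a : u1 ^ 2 ≤ F.a ^ 2 := by
    have s1 : u1 ^ 2 ≤ F.a ^ 2 * (α + β) ^ 2 := by
      rw [e1]; nlinarith [mul_pos (mul_pos hα hβ) (mul_pos ha ha)]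
    have s2 : (α + β) ^ 2 * (1 - F.a ^ 2) = 1 - u1 ^ 2 := by
      rw [e2, e3] at hs
      have : 1 - F.a ^ 2 = F.c2 q ^ 2 + F.c3 q ^ 2 := by linarith
      rw [this]; linarith
    have s3 : 0 ≤ 1 - F.a ^ 2 := by linarith [sq_nonneg F.b, sq_nonneg F.h]
    have := mul_le_mul_of_nonneg_right s1 s3
    rw [mul_assoc, s2] at this
    linarith
  have h1sq : F.h ^ 2 * u1 ^ 2 < F.a ^ 2 * u3 ^ 2 := by
    by_contra! hle
    have s0 := mul_le_mul_of_nonneg_left h1a (sq_nonneg F.h)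
    have s1 : F.a ^ 2 * u3 ^ 2 ≤ F.a ^ 2 * F.h ^ 2 := by linarith
    have s2 : u3 ^ 2 ≤ F.h ^ 2 := le_of_mul_le_mul_left s1 (by positivity)
    have s5 := mul_le_mul_of_nonneg_left s2 (sq_nonneg F.b)
    have s3 : F.h ^ 2 * u2 ^ 2 < F.h ^ 2 * F.b ^ 2 := by linarith
    have s4 : u2 ^ 2 < F.b ^ 2 := lt_of_mul_lt_mul_left s3 (by positivity)
    linarith
  have h1 : F.h * |u1| ≤ F.a * u3 := by
    have : (F.h * u1) ^ 2 < (F.a * u3) ^ 2 := by rw [mul_pow, mul_pow]; exact h1sq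
    have := (abs_lt_of_sq_lt_sq this (by positivity)).le
    rwa [abs_mul, abs_of_pos hh] at this
  have hD : 0 < u1 ^ 2 + u3 ^ 2 := by positivity
  have hb1 : 0 < 1 - F.b ^ 2 := by
    have := sq_pos_of_pos ha
    linarith [sq_nonneg F.h]
  -- k stretches the component of u orthogonal to z − w to the radius √(1 − b²) of the dual circle.
  -- Minus this vector, from the midpoint of z and w, ends on the dual arc.
  have hk2 : √((1 - F.b ^ 2) / (u1 ^ 2 + u3 ^ 2)) ^ 2 * (u1 ^ 2 + u3 ^ 2) = 1 - F.b ^ 2 := by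
    rw [Real.sq_sqrt]
    · field_simp
    · exact div_nonneg hb1.le hD.le
  have hkpos : 0 < √((1 - F.b ^ 2) / (u1 ^ 2 + u3 ^ 2)) :=
    Real.sqrt_pos.2 (div_pos hb1 hD)
  set k := √((1 - F.b ^ 2) / (u1 ^ 2 + u3 ^ 2))
  have hku : F.h < k * u3 := by
    refine lt_of_pow_lt_pow_left₀ 2 (by positivity) ?_
    rw [mul_pow]
    have s1 : F.h ^ 2 * (u1 ^ 2 + u3 ^ 2) < k ^ 2 * u3 ^ 2 * (u1 ^ 2 + u3 ^ 2) := by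
      have : k ^ 2 * u3 ^ 2 * (u1 ^ 2 + u3 ^ 2) = u3 ^ 2 * (1 - F.b ^ 2) := by rw [← hk2]; ring
      have e : 1 - F.b ^ 2 = F.a ^ 2 + F.h ^ 2 := by linarith
      rw [this, e]; linarith
    exact lt_of_mul_lt_mul_right s1 hD.le
  refine ⟨u3pos, h2, h1, k, hkpos, hku, ?_, F.mem_swap_arc.2 ⟨F.c2_pt _ _ _, ?_, ?_⟩⟩
  · rw [← hk2]; linear_combination k ^ 2 * hs
  · rw [F.c1_pt, F.c3_pt]; linear_combination hk2 - hR
  · rw [F.c3_pt]; linarith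

/-- Let p be the projection of `normal_coords` on the dual arc. For u₂ > b, u is a nonnegative
combination of z − x, z − y, z − p, and the second coordinate shows that its coefficient sum is u₂/b
> 1. -/
theorem dist_sub_le_of_lt (F : DualFrame x y z w) {q u : E3} (hq : q ∈ F.arc) {α β : ℝ}
    (hα : 0 < α) (hβ : 0 < β) (hu : u = α • (q - x) + β • (q - y)) (hn : ‖u‖ = 1)
    (hlt : F.b < inner ℝ F.f2 u) {t : E3} (tx : dist x t ≤ 1) (ty : dist y t ≤ 1)
    (ht : ∀ v ∈ F.swap.arc, dist v t ≤ 1) : dist (z - u) t ≤ 1 := by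
  obtain ⟨u3pos, h2, h1, k, hk, hku, hk2, hmem⟩ := F.normal_coords hq hα hβ hu hn
  have hR := F.sq_add
  have ha := F.a_pos
  have hb := F.b_pos
  have hh := F.h_pos
  rw [abs_of_pos (hb.trans hlt)] at h2
  set u1 := inner ℝ F.f1 u with hu1
  set u2 := inner ℝ F.f2 u with hu2
  set u3 := inner ℝ F.f3 u with hu3
  set p := F.pt (-(k * u1)) 0 (F.h - k * u3) with hp
  have hd : 0 < k * u3 - F.h := by linarith
  -- In u = A(z − x) + B(z − y) + C(z − p), the second and third coordinates determine C and G = A +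
  -- B; below, m splits G to match the first.
  obtain ⟨C, hC⟩ : ∃ C : ℝ, C = (F.b * u3 - u2 * F.h) / (F.b * (k * u3 - F.h)) := ⟨_, rfl⟩
  have hC0 : 0 ≤ C := by
    rw [hC]; exact div_nonneg (by linarith) (by positivity)
  have hCe : C * (F.b * (k * u3 - F.h)) = F.b * u3 - u2 * F.h := by
    rw [hC]; exact div_mul_cancel₀ _ (by positivity)
  obtain ⟨G, hG⟩ : ∃ G : ℝ, G = u2 / F.b - C := ⟨_, rfl⟩
  have hGb : (G + C) * F.b = u2 := by rw [hG]; field_simp; ring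
  have hGe : G * F.h + C * (k * u3) = u3 := by
    have : F.b * (G * F.h + C * (k * u3) - u3) = 0 := by linear_combination F.h * hGb + hCe
    rcases mul_eq_zero.1 this with h | h
    · exact absurd h hb.ne'
    · linarith
  -- Follows from k²(1 − u₂²) = 1 − b² and u₂ > b; it makes G nonnegative.
  have hku2 : F.b ≤ u2 * k := by
    have hu2sq : u2 ^ 2 ≤ 1 := by
      have := F.norm_sq u
      rw [hn] at this
      nlinarith [sq_nonneg u1, sq_nonneg u3]
    refine le_of_sq_le_sq ?_ (mul_nonneg (hb.trans hlt).le hk.le)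
    have hlt2 : F.b ^ 2 < u2 ^ 2 := by gcongr
    have hpos : 0 < 1 - u2 ^ 2 := by
      rcases hu2sq.eq_or_lt with h | h
      · rw [h] at hk2; nlinarith
      · linarith
    refine le_of_mul_le_mul_right ?_ hpos
    rw [mul_pow, mul_assoc, hk2]
    nlinarith
  have hG0 : 0 ≤ G := by
    have e : G * (F.b * (k * u3 - F.h)) = u3 * (u2 * k - F.b) := by
      linear_combination (k * u3 - F.h) * hGb - hCe
    have : 0 ≤ G * (F.b * (k * u3 - F.h)) := by
      rw [e]; exact mul_nonneg u3pos.le (by linarith)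
    exact nonneg_of_mul_nonneg_left this (by positivity)
  obtain ⟨m, hm⟩ : ∃ m : ℝ, m = u1 * F.h / (u3 * F.a) := ⟨_, rfl⟩
  have hm1 : |m| ≤ 1 := by
    rw [hm, abs_div, abs_mul, abs_mul, abs_of_pos hh, abs_of_pos ha, abs_of_pos u3pos,
      div_le_one (by positivity)]
    linarith
  have hma : m * F.a * u3 = u1 * F.h := by rw [hm]; field_simp
  rw [abs_le] at hm1
  have hzp : dist z p = 1 := F.swap.dist_x_of_mem hmem ▸ dist_comm _ _
  refine dist_sub_le_of_cone (x := x) (y := y) (p := p) (A := G * (1 - m) / 2)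
    (B := G * (1 + m) / 2) (C := C) ?_ ?_ hC0 ?_ hn ?_ (F.dist_xz ▸ dist_comm _ _)
    (F.dist_yz ▸ dist_comm _ _) hzp (by rwa [dist_comm]) (by rwa [dist_comm])
    (by rw [dist_comm]; exact ht p hmem)
  · have : 0 ≤ 1 - m := by linarith
    positivity
  · have : 0 ≤ 1 + m := by linarith
    positivity
  · nlinarith
  · refine F.vec_ext ?_ ?_ ?_ <;>
    simp only [inner_add_right, inner_smul_right, F.inner_f1_sub, F.inner_f2_sub, F.inner_f3_sub,
      F.x1, F.x2, F.x3, F.y1, F.y2, F.y3, F.z1, F.z2, F.z3, hp, F.c1_pt, F.c2_pt, F.c3_pt]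
    · have : u3 * (u1 - (G * m * F.a + C * (k * u1))) = 0 := by
        linear_combination (-u1) * hGe - G * hma
      rcases mul_eq_zero.1 this with h | h
      · exact absurd h u3pos.ne'
      · rw [← hu1]; linarith
    · rw [← hu2]; linarith
    · rw [← hu3]; linarith

/-- An outer normal `u` along the open arc is an inner normal along the dual arc, or the point at
distance one from `z` or `w` in direction `-u` is in all unit balls that contain the dual arc. -/
theorem normal_cases (F : DualFrame x y z w) {q u : E3} (hq : q ∈ F.arc) {α β : ℝ}
    (hα : 0 < α) (hβ : 0 < β) (hu : u = α • (q - x) + β • (q - y)) (hn : ‖u‖ = 1) :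
    (∃ p ∈ F.swap.arc, ∃ α' β' : ℝ, 0 ≤ α' ∧ 0 ≤ β' ∧ 0 < α' + β' ∧
      -u = α' • (p - z) + β' • (p - w)) ∨
    ∃ v, (v = z ∨ v = w) ∧ ∀ t : E3, dist x t ≤ 1 → dist y t ≤ 1 →
      (∀ p ∈ F.swap.arc, dist p t ≤ 1) → dist (v - u) t ≤ 1 := by
  rcases le_or_gt |inner ℝ F.f2 u| F.b with hle | hgt
  · left
    obtain ⟨u3pos, h2, h1, k, hk, hku, hk2, hmem⟩ := F.normal_coords hq hα hβ hu hn
    have hb := F.b_pos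
    refine ⟨_, hmem, ?_⟩
    set u1 := inner ℝ F.f1 u with hu1
    set u2 := inner ℝ F.f2 u with hu2
    set u3 := inner ℝ F.f3 u with hu3
    have hle2 : u2 ^ 2 ≤ F.b ^ 2 := by rw [← sq_abs]; gcongr
    have hkb : k * |u2| ≤ F.b := by
      refine le_of_sq_le_sq ?_ hb.le
      have hpos : 0 < 1 - u2 ^ 2 := by nlinarith [F.b_le]
      refine le_of_mul_le_mul_right ?_ hpos
      rw [mul_pow, sq_abs, mul_right_comm, hk2]
      nlinarith
    -- p − z and p − w agree with −ku except in the second coordinate, where they are −b and b; m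
    -- interpolates between them.
    obtain ⟨m, hm⟩ : ∃ m : ℝ, m = k * u2 / F.b := ⟨_, rfl⟩
    have hm1 : |m| ≤ 1 := by
      rw [hm, abs_div, abs_mul, abs_of_pos hk, abs_of_pos hb, div_le_one hb]; exact hkb
    have hmb : m * F.b = k * u2 := by rw [hm]; field_simp
    rw [abs_le] at hm1
    refine ⟨(1 + m) / (2 * k), (1 - m) / (2 * k), div_nonneg (by linarith) (by positivity),
      div_nonneg (by linarith) (by positivity), ?_, ?_⟩
    · rw [← add_div]; exact div_pos (by linarith) (by positivity)
    · refine F.vec_ext ?_ ?_ ?_ <;>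
      simp only [inner_add_right, inner_smul_right, inner_neg_right, F.inner_f1_sub,
        F.inner_f2_sub, F.inner_f3_sub, F.z1, F.z2, F.z3, F.w1, F.w2, F.w3, F.c1_pt, F.c2_pt,
        F.c3_pt]
      · rw [← hu1]; field_simp; ring
      · rw [← hu2]; field_simp; linear_combination 2 * hmb
      · rw [← hu3]; field_simp; ring
  · right
    rcases lt_abs.1 hgt with h | h
    · exact ⟨z, Or.inl rfl, fun t tx ty ht => F.dist_sub_le_of_lt hq hα hβ hu hn h tx ty ht⟩
    · refine ⟨w, Or.inr rfl, fun t tx ty ht =>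
        F.flip.dist_sub_le_of_lt (by rwa [F.flip_arc]) hα hβ hu hn ?_ tx ty
          (by rwa [F.flip_swap_arc])⟩
      have : inner ℝ F.flip.f2 u = -inner ℝ F.f2 u := inner_neg_left _ _
      rw [this]; exact h

end DualFrame

/-! ### Distances between edges that are not dual -/

/-- A point with two support balls is the only maximizer of each linear function in the cone of
its outer normals. -/
theorem eq_of_inner_cone_le {p v a b N : E3} {α β : ℝ} (hα : 0 ≤ α) (hβ : 0 ≤ β)
    (hαβ : 0 < α + β) (hN : N = α • (p - a) + β • (p - b)) (pa : dist p a = 1)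
    (pb : dist p b = 1) (va : dist v a ≤ 1) (vb : dist v b ≤ 1)
    (hle : inner ℝ N p ≤ inner ℝ N v) : v = p := by
  have k1 := mul_le_mul_of_nonneg_left (inner_sub_le_of_dist_le pa va) hα
  have k2 := mul_le_mul_of_nonneg_left (inner_sub_le_of_dist_le pb vb) hβ
  have h : 0 ≤ inner ℝ N (v - p) := by rw [inner_sub_right]; linarith
  rw [hN, inner_add_left, real_inner_smul_left, real_inner_smul_left] at h
  have h2 : (α + β) * ‖v - p‖ ^ 2 ≤ 0 := by linarith
  have h3 : ‖v - p‖ ^ 2 ≤ 0 := nonpos_of_mul_nonpos_right h2 hαβ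
  have h4 : ‖v - p‖ = 0 := by nlinarith [norm_nonneg (v - p)]
  exact sub_eq_zero.1 (norm_eq_zero.1 h4)

/-- The unit vectors p − a and p − b are distinct, and not opposite because |a − b| ≤ 1, so they are
linearly independent. -/
theorem cone_ne_side {p a b : E3} {A B : ℝ} (hB : 0 < B) (pa : dist p a = 1)
    (pb : dist p b = 1) (hab : a ≠ b) (dab : dist a b ≤ 1) :
    A • (p - a) + B • (p - b) ≠ p - a := by
  intro h
  rw [dist_eq_norm] at pa pb dab
  have haa : inner ℝ (p - a) (p - a) = 1 := by rw [real_inner_self_eq_norm_sq, pa]; norm_num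
  have hbb : inner ℝ (p - b) (p - b) = 1 := by rw [real_inner_self_eq_norm_sq, pb]; norm_num
  have h1 := congrArg (fun v => inner ℝ (p - a) v) h
  have h2 := congrArg (fun v => inner ℝ (p - b) v) h
  simp only [inner_add_right, inner_smul_right, haa, hbb, real_inner_comm (p - a) (p - b)] at h1 h2
  have hd := norm_sub_sq_real (p - b) (p - a)
  rw [sub_sub_sub_cancel_left, pa, pb] at hd
  have hpos : 0 < ‖a - b‖ := norm_pos_iff.2 (sub_ne_zero.2 hab)
  rw [real_inner_comm] at hd
  set c := inner ℝ (p - a) (p - b)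
  have h3 : B * ((1 - c) * (1 + c)) = 0 := by linear_combination h2 - c * h1
  have h4 : 0 < 1 - c := by nlinarith
  have h5 : 0 < 1 + c := by nlinarith
  have : 0 < B * ((1 - c) * (1 + c)) := by positivity
  linarith

theorem IsCompact.exists_farthest_pair {s t : Set E3} (hs : IsCompact s) (ht : IsCompact t)
    (hsn : s.Nonempty) (htn : t.Nonempty) :
    ∃ q ∈ s, ∃ p ∈ t, ∀ v ∈ s, ∀ v' ∈ t, dist v v' ≤ dist q p := by
  have hc : Continuous fun r : E3 × E3 => dist r.1 r.2 := continuous_dist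
  obtain ⟨⟨q, p⟩, hr, hmax⟩ := (hs.prod ht).exists_isMaxOn (hsn.prod htn) hc.continuousOn
  have hr' := Set.mem_prod.1 hr
  exact ⟨q, hr'.1, p, hr'.2, fun v hv v' hv' =>
    isMaxOn_iff.1 hmax (v, v') (Set.mk_mem_prod hv hv')⟩

theorem IsDualEdgePair.symm {X e e' : Set E3} (h : IsDualEdgePair X e e') :
    IsDualEdgePair X e' e := by
  obtain ⟨x, y, x', y', h1, h2, h3, h4⟩ := h
  exact ⟨x', y', x, y, h3, h4, h1, h2⟩

theorem IsEdgeOn.subset {X e : Set E3} {x y : E3} (h : IsEdgeOn X x y e) :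
    e ⊆ edgeLocus X x y := by
  obtain ⟨-, -, -, p, -, rfl⟩ := h
  exact connectedComponentIn_subset _ _

theorem IsEdgeOn.subset_ballIntersection {X e : Set E3} {x y : E3} (h : IsEdgeOn X x y e) :
    e ⊆ ballIntersection X := fun _ hp => (h.subset hp).1.2

theorem IsEdgeOn.dist_left {X e : Set E3} {x y p : E3} (h : IsEdgeOn X x y e)
    (hp : p ∈ closure e) : dist p x = 1 :=
  closure_minimal (fun _ hv => (h.subset hv).1.1.1) Metric.isClosed_sphere hp

theorem IsEdgeOn.dist_right {X e : Set E3} {x y p : E3} (h : IsEdgeOn X x y e)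
    (hp : p ∈ closure e) : dist p y = 1 :=
  closure_minimal (fun _ hv => (h.subset hv).1.1.2) Metric.isClosed_sphere hp

theorem IsEdgeOn.nonempty {X e : Set E3} {x y : E3} (h : IsEdgeOn X x y e) : e.Nonempty := by
  obtain ⟨-, -, -, p, hp, rfl⟩ := h
  exact ⟨p, mem_connectedComponentIn hp⟩

theorem edgeLocus_comm (X : Set E3) (x y : E3) : edgeLocus X x y = edgeLocus X y x := by
  rw [edgeLocus, edgeLocus, Set.inter_comm (Metric.sphere x 1)]

theorem exists_isEdgeOn {X : Set E3} {p a b : E3} (ha : a ∈ X) (hb : b ∈ X) (hab : a ≠ b)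
    (hp : p ∈ ballIntersection X) (hpX : p ∉ X) (pa : dist p a = 1) (pb : dist p b = 1) :
    ∃ g, IsEdgeOn X a b g ∧ p ∈ g := by
  have hm : p ∈ edgeLocus X a b := ⟨⟨⟨pa, pb⟩, hp⟩, hpX⟩
  exact ⟨_, ⟨ha, hb, hab, p, hm, rfl⟩, mem_connectedComponentIn hm⟩

theorem IsReuleauxCenterSet.dist_le_one {X : Set E3} (hX : IsReuleauxCenterSet X) {p q : E3}
    (hp : p ∈ X) (hq : q ∈ X) : dist p q ≤ 1 := by
  rw [← hX.diam_eq_one]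
  exact Metric.dist_le_diam_of_mem hX.finite.isBounded hp hq

/-- The two edges of a dual pair, as arcs in adapted coordinates. -/
structure DualEdges (X e e' : Set E3) (x y z w : E3) extends DualFrame x y z w where
  edge : IsEdgeOn X x y e
  edge' : IsEdgeOn X z w e'
  ends : HasEndpoints e z w
  ends' : HasEndpoints e' x y
  eq_arc : e = toDualFrame.arc
  eq_arc' : e' = toDualFrame.swap.arc

theorem IsDualEdgePair.exists_dualEdges {X e e' : Set E3} (hX : IsReuleauxCenterSet X)
    (h : IsDualEdgePair X e e') : ∃ x y z w : E3, Nonempty (DualEdges X e e' x y z w) := by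
  obtain ⟨x, y, z, w, he, hends, he', hends'⟩ := h
  have hz : z ∈ closure e := by
    have : z ∈ closure e \ e := by rw [hends.2]; simp
    exact this.1
  have hw : w ∈ closure e := by
    have : w ∈ closure e \ e := by rw [hends.2]; simp
    exact this.1
  obtain ⟨F⟩ := nonempty_dualFrame he.2.2.1 he'.2.2.1 (hX.dist_le_one he.1 he.2.1)
    (hX.dist_le_one he'.1 he'.2.1) (by rw [dist_comm]; exact he.dist_left hz)
    (by rw [dist_comm]; exact he.dist_left hw) (by rw [dist_comm]; exact he.dist_right hz)
    (by rw [dist_comm]; exact he.dist_right hw)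
  exact ⟨x, y, z, w, ⟨{ toDualFrame := F, edge := he, edge' := he', ends := hends, ends' := hends'
                        eq_arc := F.edge_eq_arc he hends he'.1 he'.2.1
                        eq_arc' := F.swap.edge_eq_arc he' hends' he.1 he.2.1 }⟩⟩

namespace DualEdges

variable {X e e' : Set E3} {x y z w : E3}

theorem closure_subset_union (D : DualEdges X e e' x y z w) : closure e ⊆ e ∪ X := by
  intro v hv
  by_cases h : v ∈ e
  · exact Or.inl h
  · have : v ∈ closure e \ e := ⟨hv, h⟩
    rw [D.ends.2] at this
    rcases this with rfl | rfl
    · exact Or.inr D.edge'.1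
    · exact Or.inr D.edge'.2.1

theorem closure_subset_ballIntersection (D : DualEdges X e e' x y z w) :
    closure e ⊆ ballIntersection X :=
  closure_minimal D.edge.subset_ballIntersection (isClosed_ballIntersection X)

theorem isCompact_closure (D : DualEdges X e e' x y z w) : IsCompact (closure e) :=
  (isCompact_ballIntersection ⟨x, D.edge.1⟩).of_isClosed_subset isClosed_closure
    D.closure_subset_ballIntersection

/-- Besides the two centers of an edge, no center has distance one from a point of the edge. -/
theorem eq_center (D : DualEdges X e e' x y z w) (ht : IsTight X) {p c : E3} (hp : p ∈ e)
    (hc : c ∈ X) (hpc : dist p c = 1) : c = x ∨ c = y := by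
  by_contra! hne
  -- By `lens_subset` the ball around c contains the lens of x and y, so c could be dropped, against
  -- tightness.
  refine ht c hc (Set.Subset.antisymm (fun v hv => ?_) (ballIntersection_anti Set.sdiff_subset))
  rw [mem_ballIntersection] at hv ⊢
  intro s hs
  by_cases hsc : s = c
  · subst hsc
    refine D.lens_subset (q := p) (D.eq_arc ▸ hp) (by rwa [dist_comm]) (fun t ht => ?_)
      (hv x ⟨D.edge.1, hne.1.symm⟩) (hv y ⟨D.edge.2.1, hne.2.symm⟩)
    rw [← D.eq_arc] at ht
    rw [dist_comm]
    exact mem_ballIntersection.1 (D.edge.subset_ballIntersection ht) s hs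
  · exact hv s ⟨hs, hsc⟩

/-- A point of an edge determines the two centers, hence the locus and its component. -/
theorem eq_edge (D : DualEdges X e e' x y z w) (ht : IsTight X) {p a b : E3} {g : Set E3}
    (hg : IsEdgeOn X a b g) (hpg : p ∈ g) (hpe : p ∈ e) : g = e := by
  have ha := D.eq_center ht hpe hg.1 (hg.dist_left (subset_closure hpg))
  have hb := D.eq_center ht hpe hg.2.1 (hg.dist_right (subset_closure hpg))
  have hloc : edgeLocus X a b = edgeLocus X x y := by
    have := hg.2.2.1
    rcases ha with rfl | rfl <;> rcases hb with rfl | rfl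
    · exact absurd rfl this
    · rfl
    · exact edgeLocus_comm _ _ _
    · exact absurd rfl this
  obtain ⟨-, -, -, r, -, rfl⟩ := hg
  obtain ⟨-, -, -, r', -, rfl⟩ := D.edge
  rw [connectedComponentIn_eq hpg, connectedComponentIn_eq hpe, hloc]

/-- Outer normals at points of two edges that are not dual to each other are not opposite. -/
theorem not_opposite_normals (hX : IsReuleauxCenterSet X) {f f' : Set E3} {a b c d : E3}
    (D : DualEdges X e e' x y z w) (D' : DualEdges X f f' a b c d) {x₁ y₁ z₁ w₁ : E3}
    (D₁ : DualEdges X e' e x₁ y₁ z₁ w₁)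
    (hne : f ≠ e') {q p u : E3} (hq : q ∈ e) (hp : p ∈ f) {α β α' β' : ℝ} (hα : 0 < α)
    (hβ : 0 < β) (hα' : 0 < α') (hβ' : 0 < β') (hu : u = α • (q - x) + β • (q - y))
    (hu' : -u = α' • (p - a) + β' • (p - b)) (hun : ‖u‖ = 1) : False := by
  have hpB := D'.edge.subset_ballIntersection hp
  have hpa := D'.edge.dist_left (subset_closure hp)
  have hpb := D'.edge.dist_right (subset_closure hp)
  have hunique : ∀ v ∈ ballIntersection X, inner ℝ (-u) p ≤ inner ℝ (-u) v → v = p :=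
    fun v hv hle => eq_of_inner_cone_le hα'.le hβ'.le (add_pos hα' hβ') hu' hpa hpb
      (mem_ballIntersection.1 hv a D'.edge.1) (mem_ballIntersection.1 hv b D'.edge.2.1) hle
  rcases D.normal_cases (D.eq_arc ▸ hq) hα hβ hu hun with
    ⟨r, hr, A, B, hA, hB, hAB, hr2⟩ | ⟨v, hv, hball⟩
  · rw [← D.eq_arc'] at hr
    have hrB := D.edge'.subset_ballIntersection hr
    have hrp : r = p := by
      rcases le_total (inner ℝ (-u) p) (inner ℝ (-u) r) with hle | hle
      · exact hunique r hrB hle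
      · exact (eq_of_inner_cone_le hA hB hAB hr2 (D.edge'.dist_left (subset_closure hr))
          (D.edge'.dist_right (subset_closure hr)) (mem_ballIntersection.1 hpB z D.edge'.1)
          (mem_ballIntersection.1 hpB w D.edge'.2.1) hle).symm
    exact hne (D₁.eq_edge hX.tight D'.edge hp (hrp ▸ hr))
  · have hvX : v ∈ X := by
      rcases hv with rfl | rfl
      · exact D.edge'.1
      · exact D.edge'.2.1
    have hB : v - u ∈ ballIntersection X := mem_ballIntersection.2 fun t ht =>
      hball t (hX.dist_le_one D.edge.1 ht) (hX.dist_le_one D.edge.2.1 ht) fun r hr =>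
        mem_ballIntersection.1 (D.edge'.subset_ballIntersection (D.eq_arc' ▸ hr)) t ht
    have hd : dist (v - u) v = 1 := by rw [dist_eq_norm, sub_sub_cancel_left, norm_neg, hun]
    -- Both p and v − u support in direction −u, and support points are unique. So v is a center
    -- active at p, and −u = p − v is a side of the normal cone at p instead of an interior vector.
    have hvp : v - u = p := by
      rcases le_total (inner ℝ (-u) p) (inner ℝ (-u) (v - u)) with hle | hle
      · exact hunique _ hB hle
      · exact (eq_of_inner_cone_le (α := 1) (β := 0) (a := v) (b := v) zero_le_one le_rfl
          (by norm_num) (by simp) hd hd (mem_ballIntersection.1 hpB v hvX)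
          (mem_ballIntersection.1 hpB v hvX) hle).symm
    rw [hvp] at hd
    have huv : p - v = -u := by rw [← hvp]; abel
    have hab := D'.edge.2.2.1
    have dab := hX.dist_le_one D'.edge.1 D'.edge.2.1
    rcases D'.eq_center hX.tight hp hvX hd with rfl | rfl
    · exact cone_ne_side hβ' hpa hpb hab dab (hu'.symm.trans huv.symm)
    · rw [add_comm] at hu'
      exact cone_ne_side hα' hpb hpa hab.symm (by rwa [dist_comm])
        (hu'.symm.trans huv.symm)

/-- The farthest point on an edge from a point of the Reuleaux polyhedron sees that point
between the two centers of the edge. -/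
theorem exists_cone (D : DualEdges X e e' x y z w) {q p : E3} (hq : q ∈ e)
    (hp : p ∈ ballIntersection X) (hpX : p ∉ X) (hmax : ∀ v ∈ e, dist p v ≤ dist p q)
    (h1 : 1 ≤ dist p q) :
    ∃ α β : ℝ, 0 < α ∧ 0 < β ∧ 1 < α + β ∧ q - p = α • (q - x) + β • (q - y) :=
  D.exists_cone_of_farthest (D.eq_arc ▸ hq) (mem_ballIntersection.1 hp z D.edge'.1)
    (mem_ballIntersection.1 hp w D.edge'.2.1) (fun v hv => hmax v (D.eq_arc ▸ hv)) h1
    (fun h => hpX (h ▸ D.edge.1)) (fun h => hpX (h ▸ D.edge.2.1))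

/-- Points of two edges that are not dual to each other have distance at most one. -/
theorem dist_le_one (hX : IsReuleauxCenterSet X) {f f' : Set E3} {a b c d : E3}
    (D : DualEdges X e e' x y z w) (D' : DualEdges X f f' a b c d) {x₁ y₁ z₁ w₁ : E3}
    (D₁ : DualEdges X e' e x₁ y₁ z₁ w₁)
    (hne : f ≠ e') {q p : E3} (hq : q ∈ e) (hp : p ∈ f) : dist q p ≤ 1 := by
  by_contra! hlt
  obtain ⟨q₀, hq₀, p₀, hp₀, hmax⟩ := D.isCompact_closure.exists_farthest_pair
    D'.isCompact_closure ⟨q, subset_closure hq⟩ ⟨p, subset_closure hp⟩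
  replace hlt : 1 < dist q₀ p₀ := hlt.trans_le (hmax q (subset_closure hq) p (subset_closure hp))
  have hqB := D.closure_subset_ballIntersection hq₀
  have hpB := D'.closure_subset_ballIntersection hp₀
  have hqX : q₀ ∉ X := fun h => by
    have := mem_ballIntersection.1 hpB q₀ h
    rw [dist_comm] at this; linarith
  have hpX : p₀ ∉ X := fun h => by
    have := mem_ballIntersection.1 hqB p₀ h
    linarith
  have hq : q₀ ∈ e := (D.closure_subset_union hq₀).resolve_right hqX
  have hp : p₀ ∈ f := (D'.closure_subset_union hp₀).resolve_right hpX
  obtain ⟨α, β, hα, hβ, -, hN⟩ := D.exists_cone hq hpB hpX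
    (fun v hv => by
      rw [dist_comm p₀, dist_comm p₀]
      exact hmax v (subset_closure hv) p₀ hp₀)
    (by rw [dist_comm]; exact hlt.le)
  obtain ⟨α', β', hα', hβ', -, hN'⟩ := D'.exists_cone hp hqB hqX
    (fun v hv => hmax q₀ hq₀ v (subset_closure hv)) hlt.le
  have hpos : 0 < ‖q₀ - p₀‖ := by rw [← dist_eq_norm]; linarith
  have hk0 : 0 < (‖q₀ - p₀‖)⁻¹ := inv_pos.2 hpos
  refine not_opposite_normals hX D D' D₁ hne hq hp (mul_pos hk0 hα) (mul_pos hk0 hβ)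
    (mul_pos hk0 hα') (mul_pos hk0 hβ') (u := (‖q₀ - p₀‖)⁻¹ • (q₀ - p₀)) ?_ ?_
    (norm_inv_norm_smul hpos)
  · rw [mul_smul, mul_smul, ← smul_add, ← hN]
  · rw [mul_smul, mul_smul, ← smul_add, ← hN', ← smul_neg, neg_sub]

end DualEdges

/-! ### Active balls -/

/-- Moving into all active balls stays in the ball intersection. -/
theorem exists_add_smul_mem_ballIntersection {S : Set E3} (hS : IsCompact S) {p v : E3}
    (hp : p ∈ ballIntersection S) (hv : ∀ t ∈ S, dist p t = 1 → 0 < inner ℝ v (t - p)) :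
    ∃ ε : ℝ, 0 < ε ∧ p + ε • v ∈ ballIntersection S := by
  -- Compactness makes ε uniform in t: near an active t the squared distance decreases to first
  -- order, near the others the distance stays below 1.
  have key : ∀ᶠ ε : ℝ in nhds 0, ∀ t ∈ S, dist p t ≤ 1 → 0 < ε → dist (p + ε • v) t ≤ 1 := by
    refine hS.eventually_forall_of_forall_eventually fun t ht => ?_
    rcases (mem_ballIntersection.1 hp t ht).eq_or_lt with h1 | h1
    · have hc : ∀ᶠ r : ℝ × E3 in nhds (0, t), r.1 * ‖v‖ ^ 2 < 2 * inner ℝ v (r.2 - p) := by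
        refine (isOpen_lt (by fun_prop) (by fun_prop)).mem_nhds ?_
        simpa using hv t ht h1
      filter_upwards [hc] with r hr hpr hr0
      have e : p + r.1 • v - r.2 = r.1 • v - (r.2 - p) := by abel
      rw [dist_comm, dist_eq_norm] at hpr
      rw [dist_eq_norm, ← sq_le_one_iff₀ (norm_nonneg _), e, norm_sub_sq_real, norm_smul,
        real_inner_smul_left, Real.norm_of_nonneg hr0.le]
      have h2 : ‖r.2 - p‖ ^ 2 ≤ 1 := by rwa [sq_le_one_iff₀ (norm_nonneg _)]
      have h3 := mul_lt_mul_of_pos_left hr hr0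
      nlinarith
    · have hc : ∀ᶠ r : ℝ × E3 in nhds (0, t), dist (p + r.1 • v) r.2 < 1 := by
        refine (isOpen_lt (by fun_prop) (by fun_prop)).mem_nhds ?_
        simpa using h1
      filter_upwards [hc] with r hr _ _ using hr.le
  obtain ⟨ε, hε, h0⟩ := ((key.filter_mono nhdsWithin_le_nhds).and
    (self_mem_nhdsWithin (a := (0 : ℝ)) (s := Set.Ioi 0))).exists
  exact ⟨ε, h0, mem_ballIntersection.2 fun t ht => hε t ht (mem_ballIntersection.1 hp t ht) h0⟩

/-- If only the ball around `s` is active at `p`, then a locally farthest point `p` from `p'`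
lies on the line through `p'` and `s`. -/
theorem sub_eq_smul_of_farthest {S : Set E3} (hS : IsCompact S) {p p' s : E3}
    (hp : p ∈ ballIntersection S) (hs : dist p s = 1) (hone : ∀ t ∈ S, dist p t = 1 → t = s)
    (hmax : ∀ v ∈ ballIntersection S, dist v p' ≤ dist p p') (hpp : 0 < dist p p') :
    p - p' = dist p p' • (p - s) := by
  rw [dist_eq_norm] at hpp hs
  set k := p - p' with hk
  set n := s - p with hn
  have hn1 : ‖n‖ = 1 := by rw [hn, norm_sub_rev]; exact hs
  set w := (‖k‖)⁻¹ • k with hw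
  have hw1 : ‖w‖ = 1 := norm_inv_norm_smul hpp
  have hkw : k = ‖k‖ • w := by rw [hw, smul_smul, mul_inv_cancel₀ hpp.ne', one_smul]
  -- Unless w = −n, the vector w + n points into the only active ball and away from p'.
  by_cases hcase : 0 < 1 + inner ℝ w n
  · exfalso
    obtain ⟨ε, hε, hmem⟩ := exists_add_smul_mem_ballIntersection hS (v := w + n) hp (fun t ht h1 => by
      rw [hone t ht h1, ← hn, inner_add_left, real_inner_self_eq_norm_sq, hn1]; linarith)
    have h1 := hmax _ hmem
    have e : p + ε • (w + n) - p' = k + ε • (w + n) := by rw [hk]; abel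
    have h2 := norm_add_sq_real k (ε • (w + n))
    rw [dist_eq_norm, dist_eq_norm, e] at h1
    have h3 : 0 < inner ℝ k (ε • (w + n)) := by
      rw [hkw, inner_smul_right, real_inner_smul_left, inner_add_right,
        real_inner_self_eq_norm_sq, hw1, one_pow]
      positivity
    have h4 := pow_le_pow_left₀ (norm_nonneg _) h1 2
    nlinarith [sq_nonneg ‖ε • (w + n)‖]
  · have h1 := norm_add_sq_real w n
    rw [hw1, hn1] at h1
    have h2 : ‖w + n‖ = 0 := by nlinarith [norm_nonneg (w + n)]
    have h3 : w = p - s := by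
      rw [norm_eq_zero] at h2
      rw [eq_neg_of_add_eq_zero_left h2, hn, neg_sub]
    rw [dist_eq_norm, ← hk, ← h3]
    exact hkw

/-- A point strictly between two points of a unit ball is in the open ball. -/
theorem dist_lt_one_of_between {p p' s t : E3} (hs : dist p s = 1) (hd : 1 < dist p p')
    (hline : p - p' = dist p p' • (p - s)) (hp : dist p t ≤ 1) (hp' : dist p' t ≤ 1) :
    dist s t < 1 := by
  set d := dist p p'
  set n := p - s with hn
  have hn1 : ‖n‖ = 1 := by rw [hn, ← dist_eq_norm, hs]
  set m := s - t with hm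
  have e1 : p - t = n + m := by rw [hn, hm]; abel
  have e2 : p' - t = m - (d - 1) • n := by
    have : p' = p - d • n := by rw [← hline]; abel
    rw [this, hm, sub_smul, one_smul, hn]; abel
  rw [dist_eq_norm] at hp hp' ⊢
  rw [← sq_le_one_iff₀ (norm_nonneg _), e1, norm_add_sq_real, hn1] at hp
  rw [← sq_le_one_iff₀ (norm_nonneg _), e2, norm_sub_sq_real, norm_smul, hn1,
    Real.norm_of_nonneg (by linarith), inner_smul_right, real_inner_comm] at hp'
  rw [← sq_lt_one_iff₀ (norm_nonneg _)]
  -- Adding d − 1 times the first bound to the second gives |m|² ≤ 2 − d < 1.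
  nlinarith

/-- A point on a unit circle around `q`, strictly between `x` and `y`, lies on no other unit
sphere whose ball contains `x` and `y`. -/
theorem eq_of_arc_point {x y p q t : E3} {α β : ℝ} (hα : 0 < α) (hβ : 0 < β) (hαβ : 1 < α + β)
    (h : q - p = α • (q - x) + β • (q - y)) (hpq : dist p q = 1) (hpt : dist p t = 1)
    (hqx : dist q x = 1) (hqy : dist q y = 1) (hxt : dist x t ≤ 1) (hyt : dist y t ≤ 1) :
    t = q := by
  have hpos : 0 < ‖q - t‖ ∨ t = q := by
    rcases eq_or_ne t q with h | h
    · exact Or.inr h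
    · exact Or.inl (norm_pos_iff.2 (sub_ne_zero.2 h.symm))
  rcases hpos with hpos | h'
  swap
  · exact h'
  exfalso
  have hk : ∀ v : E3, dist q v = 1 → dist v t ≤ 1 →
      inner ℝ (q - v) (q - t) ≥ ‖q - t‖ ^ 2 / 2 := by
    intro v hqv hvt
    have e : v - t = (q - t) - (q - v) := by abel
    rw [dist_eq_norm] at hqv hvt
    rw [← sq_le_one_iff₀ (norm_nonneg _), e, norm_sub_sq_real, hqv, real_inner_comm] at hvt
    linarith
  have k1 := mul_le_mul_of_nonneg_left (hk x hqx hxt) hα.le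
  have k2 := mul_le_mul_of_nonneg_left (hk y hqy hyt) hβ.le
  -- As p is on the spheres around q and t, the bound of `hk` is an equality at p, while the
  -- combination with α + β > 1 makes it strict.
  have k3 : inner ℝ (q - p) (q - t) = ‖q - t‖ ^ 2 / 2 := by
    have e : p - t = (q - t) - (q - p) := by abel
    have h2 : ‖q - p‖ = 1 := by rw [← dist_eq_norm, dist_comm, hpq]
    have h3 := norm_sub_sq_real (q - t) (q - p)
    rw [← e, ← dist_eq_norm, hpt, h2, real_inner_comm] at h3
    linarith
  rw [h, inner_add_left, real_inner_smul_left, real_inner_smul_left] at k3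
  have : 0 < (α + β - 1) * ‖q - t‖ ^ 2 := mul_pos (by linarith) (by positivity)
  linarith

/-- Every center whose sphere meets the Reuleaux polyhedron is at distance one from some center. -/
theorem exists_dist_eq_one {X : Set E3} (hX : IsReuleauxCenterSet X)
    (hedge : ∀ g, IsEdge X g → ∃ g', IsDualEdgePair X g g') {p s : E3} (hs : s ∈ X)
    (hp : p ∈ ballIntersection X) (hps : dist p s = 1) : ∃ t ∈ X, dist s t = 1 := by
  have hconn : IsPreconnected (Metric.sphere s 1) := by
    refine isPreconnected_sphere ?_ s 1
    rw [← Module.finrank_eq_rank]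
    simp
  -- B(X) and C are closed, cover the sphere around s and both meet it: p is in B(X), and its
  -- antipode, at distance 2 from p, is in C. A common point is in X or on an edge with center s.
  set C : Set E3 := ⋃ t ∈ X \ {s}, {v | 1 ≤ dist v t} with hC
  have hCclosed : IsClosed C := (hX.finite.subset Set.sdiff_subset).isClosed_biUnion
    fun t _ => isClosed_le continuous_const (by fun_prop)
  have hcover : Metric.sphere s 1 ⊆ ballIntersection X ∪ C := by
    intro v hv
    by_cases h : v ∈ C
    · exact Or.inr h
    · refine Or.inl (mem_ballIntersection.2 fun t ht => ?_)
      by_cases hts : t = s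
      · rw [hts]; exact le_of_eq hv
      · by_contra! hlt
        exact h (Set.mem_biUnion (⟨ht, hts⟩ : t ∈ X \ {s}) hlt.le)
  obtain ⟨t, ht, hts⟩ := Set.exists_ne_of_one_lt_ncard
    (lt_of_lt_of_le (by norm_num) hX.four_le_ncard) s
  have hanti : s + (s - p) ∈ Metric.sphere s 1 := by
    rw [mem_sphere_iff_norm, add_sub_cancel_left, ← dist_eq_norm, dist_comm, hps]
  have hantiC : s + (s - p) ∈ C := by
    refine Set.mem_biUnion (⟨ht, hts⟩ : t ∈ X \ {s}) ?_
    rw [Set.mem_ofPred_eq]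
    by_contra! hlt
    have h1 := mem_ballIntersection.1 hp t ht
    have h2 : dist (s + (s - p)) p = 2 := by
      rw [dist_eq_norm, show s + (s - p) - p = (2 : ℝ) • (s - p) by module, norm_smul,
        ← dist_eq_norm, dist_comm, hps]
      norm_num
    have h3 := dist_triangle (s + (s - p)) t p
    rw [dist_comm t p] at h3
    linarith
  obtain ⟨v, hvs, hvB, hvC⟩ := isPreconnected_closed_iff.1 hconn _ _ (isClosed_ballIntersection X)
    hCclosed hcover ⟨p, hps, hp⟩ ⟨_, hanti, hantiC⟩
  obtain ⟨t, ⟨ht, hts⟩, hvt⟩ := Set.mem_iUnion₂.1 hvC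
  by_cases hvX : v ∈ X
  · exact ⟨v, hvX, by rw [dist_comm]; exact hvs⟩
  obtain ⟨g, hg, hvg⟩ := exists_isEdgeOn hs ht (fun h => hts h.symm) hvB hvX hvs
    (le_antisymm (mem_ballIntersection.1 hvB t ht) hvt)
  obtain ⟨g', hgg⟩ := hedge g ⟨s, t, hg⟩
  obtain ⟨x, y, z, w, ⟨D⟩⟩ := hgg.exists_dualEdges hX
  refine ⟨z, D.edge'.1, ?_⟩
  rcases D.eq_center hX.tight hvg hs hvs with rfl | rfl
  · exact D.dist_xz
  · exact D.dist_yz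

/-! ### The Meissner polyhedron has constant width -/

section Pairing

variable {X : Set E3} {k : ℕ} {e e' : Fin k → Set E3}

theorem IsDualEdgePairing.exists_dual (hP : IsDualEdgePairing X e e') (g : Set E3)
    (hg : IsEdge X g) : ∃ g', IsDualEdgePair X g g' := by
  obtain ⟨i, rfl | rfl⟩ := hP.exhaustive g hg
  · exact ⟨_, hP.dual i⟩
  · exact ⟨_, (hP.dual i).symm⟩

/-- Edges lie in B(X), which settles pairs involving a center. Two chosen edges are never dual, by
injectivity of the pairing, so `DualEdges.dist_le_one` applies. -/
theorem subset_ballIntersection_union (hX : IsReuleauxCenterSet X)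
    (hP : IsDualEdgePairing X e e') :
    X ∪ ⋃ i, e i ⊆ ballIntersection (X ∪ ⋃ i, e i) := by
  have hsub : ∀ i, e i ⊆ ballIntersection X := fun i => by
    obtain ⟨x, y, z, w, ⟨D⟩⟩ := (hP.dual i).exists_dualEdges hX
    exact D.edge.subset_ballIntersection
  intro p hp
  refine mem_ballIntersection.2 fun s hs => ?_
  rcases hs with hs | hs
  · rcases hp with hp | hp
    · exact hX.dist_le_one hp hs
    · obtain ⟨i, hi⟩ := Set.mem_iUnion.1 hp
      exact mem_ballIntersection.1 (hsub i hi) s hs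
  · obtain ⟨j, hj⟩ := Set.mem_iUnion.1 hs
    rcases hp with hp | hp
    · rw [dist_comm]
      exact mem_ballIntersection.1 (hsub j hj) p hp
    · obtain ⟨i, hi⟩ := Set.mem_iUnion.1 hp
      obtain ⟨x, y, z, w, ⟨D⟩⟩ := (hP.dual i).exists_dualEdges hX
      obtain ⟨a, b, c, d, ⟨D'⟩⟩ := (hP.dual j).exists_dualEdges hX
      obtain ⟨x₁, y₁, z₁, w₁, ⟨D₁⟩⟩ := (hP.dual i).symm.exists_dualEdges hX
      refine D.dist_le_one hX D' D₁ (fun h => ?_) hi hj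
      have : Sum.elim e e' (Sum.inl j) = Sum.elim e e' (Sum.inr i) := h
      simpa using hP.injective this

/-- The edges lack only their endpoints, which are in X. -/
theorem isCompact_union (hX : IsReuleauxCenterSet X) (hP : IsDualEdgePairing X e e') :
    IsCompact (X ∪ ⋃ i, e i) := by
  have heq : X ∪ ⋃ i, e i = X ∪ ⋃ i, closure (e i) := by
    refine Set.Subset.antisymm
      (Set.union_subset_union_right _ (Set.iUnion_mono fun i => subset_closure))
      (Set.union_subset Set.subset_union_left (Set.iUnion_subset fun i v hv => ?_))
    obtain ⟨x, y, z, w, ⟨D⟩⟩ := (hP.dual i).exists_dualEdges hX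
    rcases D.closure_subset_union hv with h | h
    · exact Or.inr (Set.mem_iUnion.2 ⟨i, h⟩)
    · exact Or.inl h
  rw [heq]
  refine hX.finite.isCompact.union (isCompact_iUnion fun i => ?_)
  obtain ⟨x, y, z, w, ⟨D⟩⟩ := (hP.dual i).exists_dualEdges hX
  exact D.isCompact_closure

/-- No point of an edge outside of the pairing's first components is in the Meissner
polyhedron. -/
theorem notMem_ballIntersection_union (hX : IsReuleauxCenterSet X)
    (hP : IsDualEdgePairing X e e') {i : Fin k} {p : E3} (hp : p ∈ e' i) :
    p ∉ ballIntersection (X ∪ ⋃ i, e i) := by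
  intro hpM
  obtain ⟨x, y, z, w, ⟨D⟩⟩ := (hP.dual i).exists_dualEdges hX
  obtain ⟨q, hq⟩ := D.edge.nonempty
  have h1 := D.one_lt_dist (D.eq_arc ▸ hq) (D.eq_arc' ▸ hp)
  have h2 := mem_ballIntersection.1 hpM q (Or.inr (Set.mem_iUnion.2 ⟨i, hq⟩))
  rw [dist_comm] at h2
  linarith

/-- Outside of the set of centers, at most one ball is active. -/
theorem active_unique (hX : IsReuleauxCenterSet X) (hP : IsDualEdgePairing X e e') {p s t : E3}
    (hp : p ∈ ballIntersection (X ∪ ⋃ i, e i)) (hpS : p ∉ X ∪ ⋃ i, e i)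
    (hs : s ∈ X ∪ ⋃ i, e i) (ht : t ∈ X ∪ ⋃ i, e i) (hps : dist p s = 1) (hpt : dist p t = 1) :
    t = s := by
  have hpB : p ∈ ballIntersection X := ballIntersection_anti Set.subset_union_left hp
  have hpX : p ∉ X := fun h => hpS (Or.inl h)
  have hS := subset_ballIntersection_union hX hP
  -- As p is in M, q is a farthest point of its edge from p, so q sees p strictly between x and y
  -- and `eq_of_arc_point` applies.
  have key : ∀ q ∈ ⋃ i, e i, dist p q = 1 → ∀ r ∈ X ∪ ⋃ i, e i, dist p r = 1 → r = q := by
    intro q hq hpq r hr hpr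
    obtain ⟨i, hi⟩ := Set.mem_iUnion.1 hq
    obtain ⟨x, y, z, w, ⟨D⟩⟩ := (hP.dual i).exists_dualEdges hX
    obtain ⟨α, β, hα, hβ, hαβ, h⟩ := D.exists_cone hi hpB hpX
      (fun v hv => by
        rw [hpq]; exact mem_ballIntersection.1 hp v (Or.inr (Set.mem_iUnion.2 ⟨i, hv⟩)))
      hpq.ge
    exact eq_of_arc_point hα hβ hαβ h hpq hpr (D.edge.dist_left (subset_closure hi))
      (D.edge.dist_right (subset_closure hi))
      (mem_ballIntersection.1 (hS (Or.inl D.edge.1)) r hr)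
      (mem_ballIntersection.1 (hS (Or.inl D.edge.2.1)) r hr)
  rcases hs with hs' | hs'
  · rcases ht with ht' | ht'
    · by_contra hne
      -- Two active centers in X put p on an edge: a chosen one is part of S, and a dual one misses
      -- M.
      obtain ⟨g, hg, hpg⟩ := exists_isEdgeOn ht' hs' hne hpB hpX hpt hps
      obtain ⟨i, rfl | rfl⟩ := hP.exhaustive g ⟨t, s, hg⟩
      · exact hpS (Or.inr (Set.mem_iUnion.2 ⟨i, hpg⟩))
      · exact notMem_ballIntersection_union hX hP hpg hp
    · exact (key t ht' hpt s (Or.inl hs') hps).symm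
  · exact key s hs' hps t ht hpt

theorem dist_le_one_of_mem_ballIntersection_union (hX : IsReuleauxCenterSet X)
    (hP : IsDualEdgePairing X e e') : ∀ p ∈ ballIntersection (X ∪ ⋃ i, e i),
      ∀ q ∈ ballIntersection (X ∪ ⋃ i, e i), dist p q ≤ 1 := by
  set S := X ∪ ⋃ i, e i with hSdef
  intro r hr r' hr'
  by_contra! hlt
  have hScomp : IsCompact S := isCompact_union hX hP
  have hXne : X.Nonempty := Set.nonempty_of_ncard_ne_zero
    (by have := hX.four_le_ncard; omega)
  have hM := isCompact_ballIntersection (S := S) (hXne.mono Set.subset_union_left)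
  obtain ⟨p, hp, p', hp', hmax⟩ := hM.exists_farthest_pair hM ⟨r, hr⟩ ⟨r', hr'⟩
  replace hlt := hlt.trans_le (hmax r hr r' hr')
  have hpS : p ∉ S := fun h => by
    have := mem_ballIntersection.1 hp' p h
    rw [dist_comm] at this; linarith
  -- Without an active ball, p could move farther away from p'.
  obtain ⟨s, hs, hps⟩ : ∃ s ∈ S, dist p s = 1 := by
    by_contra! hno
    obtain ⟨ε, hε, hmem⟩ := exists_add_smul_mem_ballIntersection hScomp (v := p - p') hp
      fun t ht h1 => absurd h1 (hno t ht)
    have h1 := hmax _ hmem p' hp'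
    rw [dist_eq_norm, dist_eq_norm,
      show p + ε • (p - p') - p' = (1 + ε) • (p - p') by module, norm_smul,
      Real.norm_of_nonneg (by linarith)] at h1
    rw [dist_eq_norm] at hlt
    nlinarith
  have hline := sub_eq_smul_of_farthest hScomp hp hps
    (fun t ht h1 => active_unique hX hP hp hpS hs ht hps h1)
    (fun v hv => hmax v hv p' hp') (by linarith)
  obtain ⟨t, ht, hst⟩ : ∃ t ∈ X, dist s t = 1 := by
    rcases hs with hs | hs
    · exact exists_dist_eq_one hX hP.exists_dual hs
        (ballIntersection_anti Set.subset_union_left hp) hps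
    · obtain ⟨i, hi⟩ := Set.mem_iUnion.1 hs
      obtain ⟨x, y, z, w, ⟨D⟩⟩ := (hP.dual i).exists_dualEdges hX
      exact ⟨x, D.edge.1, D.edge.dist_left (subset_closure hi)⟩
  have := dist_lt_one_of_between hps hlt hline (mem_ballIntersection.1 hp t (Or.inl ht))
    (mem_ballIntersection.1 hp' t (Or.inl ht))
  linarith

/-- A support point has an active ball. -/
theorem exists_dist_eq_one_of_isSupport {S : Set E3} (hS : IsCompact S) {p u : E3}
    (hu : ‖u‖ = 1) (hp : p ∈ ballIntersection S)
    (hmax : ∀ z ∈ ballIntersection S, inner ℝ u z ≤ inner ℝ u p) : ∃ s ∈ S, dist p s = 1 := by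
  by_contra! hno
  obtain ⟨ε, hε, hmem⟩ := exists_add_smul_mem_ballIntersection hS (v := u) hp
    fun t ht h1 => absurd h1 (hno t ht)
  have := hmax _ hmem
  rw [inner_add_right, inner_smul_right, real_inner_self_eq_norm_sq, hu] at this
  linarith

end Pairing

theorem theoremA (M : Set E3) (hM : IsMeissnerPolyhedron M) : IsExtremeBody M := by
  obtain ⟨X, hX, e, e', hP, rfl⟩ := hM
  have hS := subset_ballIntersection_union hX hP
  have hXne : X.Nonempty := Set.nonempty_of_ncard_ne_zero
    (by have := hX.four_le_ncard; omega)
  refine isExtremeBody_of_finite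
    (isConstantWidth_ballIntersection (hXne.mono Set.subset_union_left) hS
      (dist_le_one_of_mem_ballIntersection_union hX hP)) hX.finite
    (Set.subset_union_left.trans hS) fun p hp u hu hmax => ?_
  obtain ⟨s, hs, hps⟩ := exists_dist_eq_one_of_isSupport (isCompact_union hX hP) hu hp hmax
  refine ⟨s, hS hs, hps, ?_⟩
  rcases hs with hs | hs
  · exact Or.inl hs
  · obtain ⟨i, hi⟩ := Set.mem_iUnion.1 hs
    obtain ⟨x, y, z, w, ⟨D⟩⟩ := (hP.dual i).exists_dualEdges hX
    exact Or.inr ⟨x, D.edge.1, D.edge.dist_left (subset_closure hi)⟩
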